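/- For an integer $k$, an instance of $k$-VectorSum over $\mathbb F_2$ in dimension $d$ consists of $k$ finite sets of vectors $V_1,\dots,V_k\subseteq\mathbb F_2^d$ (given explicitly) and a target $\vec t\in\mathbb F_2^d$; the question is whether there are $\vec v_1\in V_1,\dots,\vec v_k\in V_k$ with $\sum_{i=1}^k\vec v_i=\vec t$. Let $n$ denote the input size of the instance. Assume the Exponential Time Hypothesis in the following form: no deterministic algorithm decides, in time $2^{o(N)}$, the satisfiability of 3-CNF formulas on $N$ variables (clauses with one, two or three literals) in which every variable appears in at most three clauses (so that there are at most $3N$ clauses). Then $k$-VectorSum over $\mathbb F_2$ with $d=\Theta(k\log n)$ cannot be solved in $n^{o(k)}$ time. That is, there are constants $0<c_1\le c_2$ such that for no function $g$ with $g(k)=o(k)$ and no constant $C$ is there a deterministic algorithm which, on every instance ($k$ being arbitrary and part of the input) satisfying $c_1\,k\log n\le d\le c_2\,k\log n$, halts after at most $C\cdot n^{g(k)}$ steps and correctly decides whether a solution exists. (Running times are measured in a fixed deterministic model of computation that is polynomially equivalent to multi-tape Turing machines: programs over binary trees in the WHILE language, with unit cost per operation.) -/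

import Mathlib

/-! ### Model of computation

Algorithms are programs of the textbook WHILE language on binary trees: finitely many variables
holding trees, the operations `nil`, `cons`, `head`, `tail`, the test for `nil`, sequencing,
branching and loops. Every operation and every test costs one unit of time. There is no equality
test on trees, so each operation is one pointer manipulation, and the model is polynomially
equivalent to deterministic multi-tape Turing machines. -/

namespace WhileLang

/-- The data of the machine: binary trees. -/
inductive Val : Type where
  | nil : Val
  | cons : Val → Val → Val

namespace Val

/-- The number of nodes of a tree (leaves included). -/
def size : Val → ℕ
  | nil => 1
  | cons a b => size a + size b + 1

/-- Left subtree, with `head nil = nil`. -/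
def head : Val → Val
  | nil => nil
  | cons a _ => a

/-- Right subtree, with `tail nil = nil`. -/
def tail : Val → Val
  | nil => nil
  | cons _ b => b

/-- A bit as a tree. -/
def ofBool : Bool → Val
  | false => nil
  | true => cons nil nil

/-- A list of trees as a tree. -/
def ofList : List Val → Val
  | [] => nil
  | a :: l => cons a (ofList l)

/-- A natural number in unary, as a list of `n` leaves. -/
def ofNat (n : ℕ) : Val := ofList (List.replicate n nil)

end Val

/-- A store assigns a tree to every variable; a program mentions finitely many variables. -/
abbrev Store : Type := ℕ → Val

/-- Expressions. -/
inductive Exp : Type where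
  | nil : Exp
  | var : ℕ → Exp
  | cons : Exp → Exp → Exp
  | head : Exp → Exp
  | tail : Exp → Exp

namespace Exp

/-- The value of an expression in a store. -/
def eval (s : Store) : Exp → Val
  | nil => Val.nil
  | var x => s x
  | cons e f => Val.cons (eval s e) (eval s f)
  | head e => (eval s e).head
  | tail e => (eval s e).tail

/-- The time for evaluating an expression: one unit for each operation in it. -/
def cost : Exp → ℕ
  | nil => 1
  | var _ => 1
  | cons e f => cost e + cost f + 1
  | head e => cost e + 1
  | tail e => cost e + 1

end Exp

/-- Programs. Tests regard `nil` as false and every other tree as true. -/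
inductive Prog : Type where
  | assign : ℕ → Exp → Prog
  | seq : Prog → Prog → Prog
  | ite : Exp → Prog → Prog → Prog
  | loop : Exp → Prog → Prog

/-- `Exec p s t s'`: started in the store `s`, the program `p` halts after exactly `t` units of
time in the store `s'`. -/
inductive Exec : Prog → Store → ℕ → Store → Prop where
  | assign (x : ℕ) (e : Exp) (s : Store) :
      Exec (.assign x e) s (e.cost + 1) (Function.update s x (e.eval s))
  | seq {p q : Prog} {s s' s'' : Store} {t u : ℕ} :
      Exec p s t s' → Exec q s' u s'' → Exec (.seq p q) s (t + u) s''
  | ite_true {e : Exp} {p q : Prog} {s s' : Store} {t : ℕ} :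
      e.eval s ≠ Val.nil → Exec p s t s' → Exec (.ite e p q) s (e.cost + 1 + t) s'
  | ite_false {e : Exp} {p q : Prog} {s s' : Store} {t : ℕ} :
      e.eval s = Val.nil → Exec q s t s' → Exec (.ite e p q) s (e.cost + 1 + t) s'
  | loop_done {e : Exp} {p : Prog} {s : Store} :
      e.eval s = Val.nil → Exec (.loop e p) s (e.cost + 1) s
  | loop_step {e : Exp} {p : Prog} {s s' s'' : Store} {t u : ℕ} :
      e.eval s ≠ Val.nil → Exec p s t s' → Exec (.loop e p) s' u s'' →
      Exec (.loop e p) s (e.cost + 1 + t + u) s''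

/-- The initial store: the input is in variable `0`, every other variable is `nil`. -/
def initStore (input : Val) : Store := fun x => if x = 0 then input else Val.nil

/-- On this input the program halts within `T` units of time, and it accepts (leaves a tree other
than `nil` in variable `0`) if and only if `answer` holds. -/
def Prog.AnswersWithin (p : Prog) (input : Val) (answer : Prop) (T : ℝ) : Prop :=
  ∃ (t : ℕ) (s : Store), Exec p (initStore input) t s ∧ (t : ℝ) ≤ T ∧ (s 0 ≠ Val.nil ↔ answer)

end WhileLang

/-! ### 3SAT and the Exponential Time Hypothesis -/

/-- A formula in conjunctive normal form on `numVars` variables. The literal `(true, v)` is the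
variable `v`, and `(false, v)` is its negation. -/
structure CNF where
  numVars : ℕ
  clauses : List (List (Bool × Fin numVars))

namespace CNF

/-- Some assignment satisfies at least one literal of every clause. -/
def Satisfiable (φ : CNF) : Prop :=
  ∃ a : Fin φ.numVars → Bool, ∀ c ∈ φ.clauses, ∃ l ∈ c, a l.2 = l.1

/-- A 3-CNF formula: every clause is nonempty and has at most three literals. -/
def Is3CNF (φ : CNF) : Prop :=
  ∀ c ∈ φ.clauses, 1 ≤ c.length ∧ c.length ≤ 3

/-- Every variable appears in at most three clauses. -/
def AtMostThreeOccurrences (φ : CNF) : Prop :=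
  ∀ v : Fin φ.numVars, φ.clauses.countP (fun c => decide (∃ l ∈ c, l.2 = v)) ≤ 3

/-- The input given to a 3SAT algorithm: the number of variables and the list of clauses. -/
def encode (φ : CNF) : WhileLang.Val :=
  .cons (.ofNat φ.numVars)
    (.ofList (φ.clauses.map fun c =>
      .ofList (c.map fun l => .cons (.ofBool l.1) (.ofNat l.2))))

end CNF

/-- The Exponential Time Hypothesis: no deterministic algorithm decides, in time `2 ^ o(n)` for
`n` the number of variables, the satisfiability of the 3-CNF formulas in which every variable
appears in at most three clauses. (Such a formula has at most `3 * n` clauses.) -/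
def ExponentialTimeHypothesis : Prop :=
  ¬ ∃ (p : WhileLang.Prog) (g : ℕ → ℝ) (C : ℝ),
      g =o[Filter.atTop] (fun n : ℕ => (n : ℝ)) ∧
      ∀ φ : CNF, φ.Is3CNF → φ.AtMostThreeOccurrences →
        p.AnswersWithin φ.encode φ.Satisfiable (C * (2 : ℝ) ^ g φ.numVars)

/-! ### Vector sum over the field with two elements -/

/-- An instance of `k`-VectorSum over `ZMod 2` in dimension `d`: `k` finite sets of vectors, each
given as a list without repetitions, and a target vector. -/
structure VectorSumInstance where
  k : ℕ
  d : ℕ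
  group : Fin k → List (Fin d → ZMod 2)
  group_nodup : ∀ i, (group i).Nodup
  target : Fin d → ZMod 2

namespace VectorSumInstance

/-- One can choose one vector from each group so that the chosen vectors sum to the target. -/
def HasSolution (I : VectorSumInstance) : Prop :=
  ∃ v : Fin I.k → (Fin I.d → ZMod 2), (∀ i, v i ∈ I.group i) ∧ ∑ i, v i = I.target

/-- A vector over `ZMod 2` as the list of its entries. -/
def encodeVec {d : ℕ} (v : Fin d → ZMod 2) : WhileLang.Val :=
  .ofList (List.ofFn fun j => .ofBool (decide (v j = 1)))

/-- The input given to a VectorSum algorithm: the list of the `k` groups and the target. -/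
def encode (I : VectorSumInstance) : WhileLang.Val :=
  .cons (.ofList (List.ofFn fun i => .ofList ((I.group i).map encodeVec))) (encodeVec I.target)

/-- The input size `n`. -/
def size (I : VectorSumInstance) : ℕ := I.encode.size

end VectorSumInstance

/-! The proof reduces 3SAT on `N` variables to VectorSum with parameter `k` and `log n` both of
order `√N`. Cut the variables into `r = Θ(√N)` chunks of at most `r` elements each, and cut the
`O(N)` clauses in the same way into `O(r)` chunks. A coordinate, or slot, is a position in a clause
with three literals. A chunk of variables yields one vector for each assignment of the chunk: it
records the truth values of the literals over these variables and is zero elsewhere. A chunk of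
clauses yields one vector for each way to give every clause in it one of the seven nonzero truth
patterns.

Every slot belongs to exactly one variable and to exactly one clause. The sum over the variable
chunks is therefore the full truth vector of an assignment, and the sum over the clause chunks is a
vector with a nonzero pattern in every clause. Over the field with two elements the total is zero
iff the two vectors agree, so the target `0` is reachable iff the formula is satisfiable. The key
steps are `setOf_groupOf` (a group is a Minkowski sum of sets of single options),
`sum_setOf_groupOf` (the chunking is irrelevant to the total), `mem_sum_range_optionVec`, and
`zero_mem_sum_vectorGroups`.

The instance has `k = Θ(r)`, `log n = Θ(r)` up to additive constants, and `d = Θ(N) = Θ(k log n)`.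
An algorithm with running time `n ^ o(k)` would thus decide 3SAT in time `2 ^ (O(r) * o(r)) = 2 ^
o(N)`, against the hypothesis; see `exists_reduction` and `isLittleO_exponent`.

The reduction must also be a program. The predicate `CompW W f` says that `f` is computable with
time and output size polynomial in a weight `W`, and it is closed under pairing, branching, folds
and maps. The weight need not be the input size. This allows the exponential step, the listing of
all choices in a chunk, to be charged to its own output size. -/

namespace WhileLang

/-! ### Typed data and polynomially bounded computations -/

/-- Types whose elements are represented by trees. -/
class ToVal (α : Type) where
  toVal : α → Val

open ToVal

instance : ToVal Unit := ⟨fun _ => Val.nil⟩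
instance : ToVal Bool := ⟨Val.ofBool⟩
instance : ToVal ℕ := ⟨Val.ofNat⟩
instance {α β : Type} [ToVal α] [ToVal β] : ToVal (α × β) :=
  ⟨fun p => Val.cons (toVal p.1) (toVal p.2)⟩
instance {α : Type} [ToVal α] : ToVal (List α) := ⟨fun l => Val.ofList (l.map toVal)⟩

/-- The size of the tree that represents an object. -/
def vsize {α : Type} [ToVal α] (a : α) : ℕ := (toVal a).size

/-! ### Sizes of encoded objects -/

section Basic

variable {α β γ δ : Type} [ToVal α] [ToVal β] [ToVal γ] [ToVal δ]

theorem toVal_prod (a : α) (b : β) : toVal (a, b) = Val.cons (toVal a) (toVal b) := rfl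

theorem toVal_cons (a : α) (l : List α) : toVal (a :: l) = Val.cons (toVal a) (toVal l) := rfl

theorem Val.one_le_size (v : Val) : 1 ≤ v.size := by
  cases v <;> simp [Val.size]

theorem one_le_vsize (a : α) : 1 ≤ vsize a := Val.one_le_size _

theorem vsize_prod (a : α) (b : β) : vsize (a, b) = vsize a + vsize b + 1 := rfl

theorem vsize_nil : vsize ([] : List α) = 1 := rfl

theorem vsize_cons (a : α) (l : List α) : vsize (a :: l) = vsize a + vsize l + 1 := rfl

theorem vsize_bool_le (b : Bool) : vsize b ≤ 3 := by
  cases b <;> simp [vsize, toVal, Val.ofBool, Val.size]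

/-- Unary numbers and lists of units are the same trees, so arithmetic is done by list programs. -/
theorem toVal_nat_eq (n : ℕ) : toVal n = toVal (List.replicate n ()) := by
  simp [toVal, Val.ofNat]

theorem vsize_nat (n : ℕ) : vsize n = 2 * n + 1 := by
  unfold vsize
  rw [toVal_nat_eq]
  change vsize (List.replicate n ()) = _
  induction n with
  | zero => rfl
  | succ n ih =>
    rw [List.replicate_succ, vsize_cons, ih]
    change 1 + _ + 1 = _
    omega

theorem length_lt_vsize (l : List α) : l.length < vsize l := by
  induction l with
  | nil => simp [vsize_nil]
  | cons a l ih => rw [vsize_cons, List.length_cons]; omega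

theorem vsize_lt_of_mem {l : List α} {a : α} (h : a ∈ l) : vsize a < vsize l := by
  induction l with
  | nil => simp at h
  | cons b l ih =>
    rw [vsize_cons]
    rcases List.mem_cons.1 h with rfl | h
    · omega
    · have := ih h; omega

theorem vsize_append (l₁ l₂ : List α) : vsize (l₁ ++ l₂) + 1 = vsize l₁ + vsize l₂ := by
  induction l₁ with
  | nil => rw [List.nil_append, vsize_nil]; omega
  | cons a l ih => rw [List.cons_append, vsize_cons, vsize_cons]; omega

theorem vsize_list_le {l : List α} {B : ℕ} (h : ∀ a ∈ l, vsize a ≤ B) :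
    vsize l ≤ l.length * (B + 1) + 1 := by
  induction l with
  | nil => simp [vsize_nil]
  | cons a l ih =>
    have h1 := ih fun b hb => h b (List.mem_cons_of_mem _ hb)
    have h2 := h a List.mem_cons_self
    rw [vsize_cons, List.length_cons, add_mul]; omega

end Basic

/-- `T` is bounded by a polynomial in `W`. -/
def PolyLE {α : Type} (T W : α → ℕ) : Prop := ∃ c, ∀ a, T a ≤ (W a + 2) ^ c

namespace PolyLE

variable {α β : Type} {S T U W : α → ℕ}

theorem refl (W : α → ℕ) : PolyLE W W := ⟨1, fun a => by rw [pow_one]; omega⟩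

theorem const (n : ℕ) : PolyLE (fun _ => n) W :=
  -- The summand `2` in `PolyLE` makes the base at least two, so `n ≤ 2 ^ n` absorbs any constant.
  ⟨n, fun a => (Nat.lt_two_pow_self (n := n)).le.trans (Nat.pow_le_pow_left (by omega) n)⟩

theorem of_le (h : PolyLE T W) (hST : ∀ a, S a ≤ T a) : PolyLE S W := by
  obtain ⟨c, hc⟩ := h
  exact ⟨c, fun a => (hST a).trans (hc a)⟩

theorem le (hST : ∀ a, S a ≤ W a) : PolyLE S W := (refl W).of_le hST

theorem mul (hS : PolyLE S W) (hT : PolyLE T W) : PolyLE (fun a => S a * T a) W := by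
  obtain ⟨c, hc⟩ := hS
  obtain ⟨d, hd⟩ := hT
  exact ⟨c + d, fun a => by rw [pow_add]; exact Nat.mul_le_mul (hc a) (hd a)⟩

theorem add (hS : PolyLE S W) (hT : PolyLE T W) : PolyLE (fun a => S a + T a) W := by
  obtain ⟨c, hc⟩ := hS
  obtain ⟨d, hd⟩ := hT
  refine ⟨c + d + 1, fun a => ?_⟩
  have h1 : (W a + 2) ^ c ≤ (W a + 2) ^ (c + d) := Nat.pow_le_pow_right (by omega) (by omega)
  have h2 : (W a + 2) ^ d ≤ (W a + 2) ^ (c + d) := Nat.pow_le_pow_right (by omega) (by omega)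
  have h3 : (W a + 2) ^ (c + d) * 2 ≤ (W a + 2) ^ (c + d + 1) := by
    rw [pow_succ]; exact Nat.mul_le_mul_left _ (by omega)
  have := hc a
  have := hd a
  change S a + T a ≤ _
  omega

theorem pow (hS : PolyLE S W) (n : ℕ) : PolyLE (fun a => S a ^ n) W := by
  obtain ⟨c, hc⟩ := hS
  exact ⟨c * n, fun a => by rw [pow_mul]; exact Nat.pow_le_pow_left (hc a) n⟩

theorem trans (hST : PolyLE S T) (hT : PolyLE T W) : PolyLE S W := by
  obtain ⟨c, hc⟩ := hST
  exact ((hT.add (const 2)).pow c).of_le hc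

theorem comp_left (h : PolyLE T W) (f : β → α) : PolyLE (fun b => T (f b)) (fun b => W (f b)) := by
  obtain ⟨c, hc⟩ := h
  exact ⟨c, fun b => hc (f b)⟩

end PolyLE

/-- The store with `v` in variable `0`, a stack in variable `1`, and `nil` elsewhere. -/
def stackStore (v st : Val) : Store := fun x => if x = 0 then v else if x = 1 then st else Val.nil

theorem stackStore_nil (v : Val) : stackStore v Val.nil = initStore v := by
  funext x
  simp [stackStore, initStore]

theorem exec_assign_zero (e : Exp) (v st : Val) :
    Exec (.assign 0 e) (stackStore v st) (e.cost + 1)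
      (stackStore (e.eval (stackStore v st)) st) := by
  convert Exec.assign 0 e (stackStore v st) using 1
  funext x
  by_cases hx : x = 0 <;> simp [stackStore, Function.update, hx]

theorem exec_assign_one (e : Exp) (v st : Val) :
    Exec (.assign 1 e) (stackStore v st) (e.cost + 1)
      (stackStore v (e.eval (stackStore v st))) := by
  convert Exec.assign 1 e (stackStore v st) using 1
  funext x
  by_cases hx : x = 0
  · simp [stackStore, Function.update, hx]
  · by_cases hx1 : x = 1 <;> simp [stackStore, Function.update, hx, hx1]

/-- The function `f` is computed by a program whose running time and output size are polynomially
bounded in `W`. The program leaves the stack alone. -/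
def CompW {α β : Type} [ToVal α] [ToVal β] (W : α → ℕ) (f : α → β) : Prop :=
  ∃ (p : Prog) (T : α → ℕ), PolyLE T W ∧ PolyLE (fun a => vsize (f a)) W ∧
    ∀ a st, ∃ t ≤ T a, Exec p (stackStore (toVal a) st) t (stackStore (toVal (f a)) st)

/-- Functions computable in polynomial time. -/
abbrev Poly {α β : Type} [ToVal α] [ToVal β] (f : α → β) : Prop := CompW (fun a => vsize a) f

/-! ### Closure properties: composition, pairing, branching, folds -/

namespace CompW

variable {α β γ δ : Type} [ToVal α] [ToVal β] [ToVal γ] [ToVal δ] {W W' : α → ℕ}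

theorem size {f : α → β} (hf : CompW W f) : PolyLE (fun a => vsize (f a)) W := by
  obtain ⟨_, _, _, h, _⟩ := hf
  exact h

theorem mono {f : α → β} (hf : CompW W f) (h : PolyLE W W') : CompW W' f := by
  obtain ⟨p, T, hT, hs, hp⟩ := hf
  exact ⟨p, T, hT.trans h, hs.trans h, hp⟩

theorem comp {f : α → β} {g : β → γ} {V : β → ℕ} (hg : CompW V g) (hf : CompW W f)
    (h : PolyLE (fun a => V (f a)) W) : CompW W (fun a => g (f a)) := by
  obtain ⟨p, T, hT, hs, hp⟩ := hf
  obtain ⟨q, U, hU, hs', hq⟩ := hg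
  refine ⟨.seq p q, fun a => T a + U (f a), hT.add ((hU.comp_left f).trans h),
    (hs'.comp_left f).trans h, fun a st => ?_⟩
  obtain ⟨t, ht, h1⟩ := hp a st
  obtain ⟨u, hu, h2⟩ := hq (f a) st
  exact ⟨t + u, by dsimp only; omega, .seq h1 h2⟩

/-- Post-composition with a polynomial-time function. -/
theorem poly_comp {f : α → β} {g : β → γ} (hg : Poly g) (hf : CompW W f) :
    CompW W (fun a => g (f a)) :=
  hg.comp hf hf.size

theorem of_exp {f : α → β} (e : Exp)
    (he : ∀ a st, e.eval (stackStore (toVal a) st) = toVal (f a))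
    (hs : PolyLE (fun a => vsize (f a)) W) : CompW W f :=
  ⟨.assign 0 e, fun _ => e.cost + 1, .const _, hs, fun a st =>
    ⟨_, le_rfl, by rw [← he a st]; exact exec_assign_zero e _ st⟩⟩

/-- Different types may share a tree, for example a pair `(b, l)` and the list `b :: l`; conversions
between them cost a constant. -/
theorem cast {f : α → β} (h : ∀ a, toVal (f a) = toVal a) : Poly f :=
  of_exp (.var 0) (fun a st => by simp [Exp.eval, stackStore, h])
    (PolyLE.le fun a => by simp [vsize, h])

theorem id : Poly (fun a : α => a) := cast fun _ => rfl

/-- The stack expression that builds a given tree. -/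
def quote : Val → Exp
  | .nil => .nil
  | .cons a b => .cons (quote a) (quote b)

theorem eval_quote (v : Val) (s : Store) : (quote v).eval s = v := by
  induction v with
  | nil => rfl
  | cons a b iha ihb => simp [quote, Exp.eval, iha, ihb]

theorem const (b : β) : CompW W (fun _ => b) :=
  of_exp (quote (toVal b)) (fun _ _ => eval_quote _ _) (.const _)

theorem fst : Poly (fun p : α × β => p.1) :=
  of_exp (.head (.var 0)) (fun _ _ => rfl)
    (PolyLE.le fun p => by change vsize p.1 ≤ vsize (p.1, p.2); rw [vsize_prod]; omega)

theorem snd : Poly (fun p : α × β => p.2) :=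
  of_exp (.tail (.var 0)) (fun _ _ => rfl)
    (PolyLE.le fun p => by change vsize p.2 ≤ vsize (p.1, p.2); rw [vsize_prod]; omega)

/-- The argument and then the first result are saved on the stack while `p` and `q` run. This is why
`CompW` quantifies over the stack contents. The constant `30` covers the assignments around the two
calls. -/
theorem pair {f : α → β} {g : α → γ} (hf : CompW W f) (hg : CompW W g) :
    CompW W (fun a => (f a, g a)) := by
  obtain ⟨p, T, hT, hs, hp⟩ := hf
  obtain ⟨q, U, hU, hs', hq⟩ := hg
  refine ⟨.seq (.assign 1 (.cons (.var 0) (.var 1))) (.seq p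
    (.seq (.assign 1 (.cons (.var 0) (.var 1))) (.seq (.assign 0 (.head (.tail (.var 1))))
    (.seq q (.seq (.assign 0 (.cons (.head (.var 1)) (.var 0)))
      (.assign 1 (.tail (.tail (.var 1))))))))), fun a => T a + U a + 30,
    (hT.add hU).add (.const 30), ((hs.add hs').add (.const 1)).of_le fun a => le_of_eq rfl,
    fun a st => ?_⟩
  obtain ⟨t, ht, h1⟩ := hp a (.cons (toVal a) st)
  obtain ⟨u, hu, h2⟩ := hq a (.cons (toVal (f a)) (.cons (toVal a) st))
  refine ⟨_, ?_, .seq (exec_assign_one _ _ _) (.seq h1 (.seq (exec_assign_one _ _ _)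
    (.seq (exec_assign_zero _ _ _) (.seq h2 (.seq (exec_assign_zero _ _ _)
      (exec_assign_one _ _ _))))))⟩
  simp only [Exp.cost]
  omega

theorem ite {c : α → Bool} {f g : α → β} (hc : CompW W c) (hf : CompW W f) (hg : CompW W g) :
    CompW W (fun a => if c a then f a else g a) := by
  obtain ⟨r, R, hR, -, hr⟩ := hc
  obtain ⟨p, T, hT, hs, hp⟩ := hf
  obtain ⟨q, U, hU, hs', hq⟩ := hg
  refine ⟨.seq (.assign 1 (.cons (.var 0) (.var 1))) (.seq r (.ite (.var 0)
    (.seq (.assign 0 (.head (.var 1))) (.seq (.assign 1 (.tail (.var 1))) p))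
    (.seq (.assign 0 (.head (.var 1))) (.seq (.assign 1 (.tail (.var 1))) q)))),
    fun a => R a + (T a + U a) + 30,
    (hR.add (hT.add hU)).add (.const 30),
    (hs.add hs').of_le fun a => ?_, fun a st => ?_⟩
  · dsimp only; split <;> omega
  obtain ⟨t, ht, h1⟩ := hr a (.cons (toVal a) st)
  obtain ⟨u, hu, h2⟩ := hp a st
  obtain ⟨w, hw, h3⟩ := hq a st
  dsimp only
  cases hca : c a with
  | true =>
    rw [hca] at h1
    rw [if_pos rfl]
    refine ⟨_, ?_, .seq (exec_assign_one _ _ _) (.seq h1 (.ite_true ?_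
      (.seq (exec_assign_zero _ _ _) (.seq (exec_assign_one _ _ _) h2))))⟩
    · simp only [Exp.cost]; omega
    · simp [Exp.eval, stackStore, toVal, Val.ofBool]
  | false =>
    rw [hca] at h1
    rw [if_neg Bool.false_ne_true]
    refine ⟨_, ?_, .seq (exec_assign_one _ _ _) (.seq h1 (.ite_false ?_
      (.seq (exec_assign_zero _ _ _) (.seq (exec_assign_one _ _ _) h3))))⟩
    · simp only [Exp.cost]; omega
    · simp [Exp.eval, stackStore, toVal, Val.ofBool]

/-- The body of the program for a fold: one list element is moved into the argument of `p`. -/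
def foldBody (p : Prog) : Prog :=
  .seq (.assign 1 (.cons (.cons (.tail (.head (.var 0))) (.head (.tail (.var 0)))) (.var 1)))
  (.seq (.assign 0 (.cons (.head (.tail (.var 0)))
    (.cons (.tail (.tail (.var 0))) (.head (.head (.var 0))))))
  (.seq p (.seq (.assign 0 (.cons (.head (.head (.var 1)))
    (.cons (.tail (.head (.var 1))) (.var 0))))
  (.assign 1 (.tail (.var 1))))))

/-- The time bound `M` for the step is required only at the accumulators that really occur, those
reached after a prefix `l₁`. A uniform bound over all accumulators would not exist. -/
theorem exec_fold {step : α → β → γ → β} {p : Prog} (a : α) {M : ℕ} (st : Val) (l : List γ) (b : β)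
    (hp : ∀ l₁ x l₂, l = l₁ ++ x :: l₂ → ∀ st, ∃ t ≤ M,
      Exec p (stackStore (toVal (a, l₁.foldl (step a) b, x)) st) t
        (stackStore (toVal (step a (l₁.foldl (step a) b) x)) st)) :
    ∃ t ≤ l.length * (M + 50) + 3, Exec (.loop (.head (.var 0)) (foldBody p))
      (stackStore (toVal (l, a, b)) st) t
      (stackStore (toVal (([] : List γ), a, l.foldl (step a) b)) st) := by
  induction l generalizing b with
  | nil => exact ⟨_, by simp [Exp.cost], .loop_done rfl⟩
  | cons x l ih =>
    obtain ⟨t, ht, h1⟩ := hp [] x l rfl (.cons (.cons (toVal l) (toVal a)) st)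
    obtain ⟨u, hu, h2⟩ := ih (step a b x) fun l₁ y l₂ hl st =>
      hp (x :: l₁) y l₂ (by rw [hl]; rfl) st
    refine ⟨_, ?_, .loop_step (by simp [Exp.eval, stackStore, toVal_prod, toVal_cons, Val.head])
      (.seq (exec_assign_one _ _ _) (.seq (exec_assign_zero _ _ _) (.seq h1
        (.seq (exec_assign_zero _ _ _) (exec_assign_one _ _ _))))) h2⟩
    simp only [Exp.cost, List.length_cons, add_mul]
    omega

/-- Iterating a polynomial-time step can square the size each time, so polynomial time for the step
alone is not enough. The bound `B` on the weights of all reachable states is what makes the total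
polynomial. -/
theorem foldl {step : α → β → γ → β} {l : α → List γ} {b : α → β} {V : α × β × γ → ℕ}
    {B : α → ℕ} (hs : CompW V (fun p : α × β × γ => step p.1 p.2.1 p.2.2)) (hl : CompW W l)
    (hb : CompW W b) (ha : PolyLE (fun a => vsize a) W) (hB : PolyLE B W)
    (hV : ∀ a l₁ x l₂, l a = l₁ ++ x :: l₂ → V (a, l₁.foldl (step a) (b a), x) ≤ B a)
    (hout : ∀ a, vsize ((l a).foldl (step a) (b a)) ≤ B a) :
    CompW W (fun a => (l a).foldl (step a) (b a)) := by
  have hinit : CompW W (fun a => (l a, a, b a)) := hl.pair ((id.mono ha).pair hb)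
  obtain ⟨p, T, hT, -, hp⟩ := hinit
  obtain ⟨q, U, ⟨c, hU⟩, -, hq⟩ := hs
  refine ⟨.seq p (.seq (.loop (.head (.var 0)) (foldBody q)) (.assign 0 (.tail (.tail (.var 0))))),
    fun a => T a + (vsize (l a) * ((B a + 2) ^ c + 50) + 10),
    hT.add ((hl.size.mul (((hB.add (.const 2)).pow c).add (.const 50))).add (.const 10)),
    hB.of_le hout, fun a st => ?_⟩
  obtain ⟨t, ht, h1⟩ := hp a st
  obtain ⟨u, hu, h2⟩ := exec_fold (step := step) (p := q) a (M := (B a + 2) ^ c) st (l a) (b a)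
    fun l₁ x l₂ h st => by
      obtain ⟨v, hv, h3⟩ := hq (a, l₁.foldl (step a) (b a), x) st
      exact ⟨v, (hv.trans (hU _)).trans (Nat.pow_le_pow_left (by have := hV a l₁ x l₂ h; omega) c),
        h3⟩
  refine ⟨_, ?_, .seq h1 (.seq h2 (exec_assign_zero _ _ _))⟩
  have : (l a).length * ((B a + 2) ^ c + 50) ≤ vsize (l a) * ((B a + 2) ^ c + 50) :=
    Nat.mul_le_mul_right _ (length_lt_vsize _).le
  simp only [Exp.cost]
  omega

end CompW

end WhileLang

namespace WhileLang

open ToVal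

/-! ### Operations on lists and numbers -/

section Sizes

variable {α β : Type} [ToVal α] [ToVal β]

theorem vsize_reverse (l : List α) : vsize l.reverse = vsize l := by
  induction l with
  | nil => rfl
  | cons a l ih =>
    have := vsize_append l.reverse [a]
    rw [List.reverse_cons, vsize_cons]
    rw [vsize_cons, vsize_nil, ih] at this
    omega

theorem vsize_flatten_le (l : List (List α)) : vsize l.flatten ≤ vsize l := by
  induction l with
  | nil => rfl
  | cons a l ih =>
    have := vsize_append a l.flatten
    rw [List.flatten_cons, vsize_cons]
    omega

theorem vsize_tail_le (l : List α) : vsize l.tail ≤ vsize l := by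
  cases l with
  | nil => rfl
  | cons a l => rw [List.tail_cons, vsize_cons]; omega

end Sizes

theorem foldl_flip_cons {α : Type} (l b : List α) :
    l.foldl (fun acc x => x :: acc) b = l.reverse ++ b := by
  induction l generalizing b with
  | nil => rfl
  | cons a l ih => rw [List.foldl_cons, ih]; simp

namespace CompW

variable {α β γ δ ε : Type} [ToVal α] [ToVal β] [ToVal γ] [ToVal δ] [ToVal ε] {W : α → ℕ}

theorem fst' {f : α → β × γ} (hf : CompW W f) : CompW W (fun a => (f a).1) := fst.poly_comp hf

theorem snd' {f : α → β × γ} (hf : CompW W f) : CompW W (fun a => (f a).2) := snd.poly_comp hf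

theorem cons {f : α → β} {g : α → List β} (hf : CompW W f) (hg : CompW W g) :
    CompW W (fun a => f a :: g a) :=
  (show Poly (fun p : β × List β => p.1 :: p.2) from cast fun _ => rfl).poly_comp (hf.pair hg)

theorem tail {f : α → List β} (hf : CompW W f) : CompW W (fun a => (f a).tail) :=
  (show Poly (fun l : List β => l.tail) from
    of_exp (.tail (.var 0)) (fun l _ => by cases l <;> rfl)
      (PolyLE.le vsize_tail_le)).poly_comp hf

theorem isEmpty {f : α → List β} (hf : CompW W f) : CompW W (fun a => (f a).isEmpty) := by
  refine (show Poly (fun l : List β => l.isEmpty) from ?_).poly_comp hf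
  refine ⟨.ite (.var 0) (.assign 0 .nil) (.assign 0 (.cons .nil .nil)), fun _ => 10, .const _,
    (PolyLE.const 3).of_le fun l => vsize_bool_le _, fun l st => ?_⟩
  cases l with
  | nil => exact ⟨_, by simp [Exp.cost], .ite_false rfl (exec_assign_zero _ _ _)⟩
  | cons a l =>
    exact ⟨_, by simp [Exp.cost], .ite_true (by simp [Exp.eval, stackStore, toVal_cons])
      (exec_assign_zero _ _ _)⟩

theorem headD {f : α → List β} {d : α → β} (hf : CompW W f) (hd : CompW W d) :
    CompW W (fun a => (f a).headD (d a)) := by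
  refine (show Poly (fun p : List β × β => p.1.headD p.2) from ?_).poly_comp (hf.pair hd)
  refine ⟨.ite (.head (.var 0)) (.assign 0 (.head (.head (.var 0)))) (.assign 0 (.tail (.var 0))),
    fun _ => 10, .const _, PolyLE.le fun p => ?_, fun p st => ?_⟩
  · obtain ⟨l, d⟩ := p
    cases l with
    | nil => rw [vsize_prod]; change vsize d ≤ _; omega
    | cons b l => rw [vsize_prod, vsize_cons]; change vsize b ≤ _; omega
  · obtain ⟨l, d⟩ := p
    cases l with
    | nil => exact ⟨_, by simp [Exp.cost], .ite_false rfl (exec_assign_zero _ _ _)⟩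
    | cons b l =>
      exact ⟨_, by simp [Exp.cost],
        .ite_true (by simp [Exp.eval, stackStore, toVal_prod, toVal_cons, Val.head])
        (exec_assign_zero _ _ _)⟩

/-- A fold with a polynomial-time step whose intermediate results are polynomially bounded. -/
theorem foldl_poly {step : α → β → γ → β} {l : α → List γ} {b : α → β}
    {B : α → ℕ} (hs : Poly (fun p : α × β × γ => step p.1 p.2.1 p.2.2)) (hl : CompW W l)
    (hb : CompW W b) (ha : PolyLE (fun a => vsize a) W) (hB : PolyLE B W)
    (hout : ∀ a l₁ l₂, l a = l₁ ++ l₂ → vsize (l₁.foldl (step a) (b a)) ≤ B a) :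
    CompW W (fun a => (l a).foldl (step a) (b a)) := by
  refine foldl (B := fun a => vsize a + (B a + vsize (l a)) + 2) hs hl hb ha
    ((ha.add (hB.add hl.size)).add (.const 2)) (fun a l₁ x l₂ h => ?_) fun a => ?_
  · have h1 := hout a l₁ (x :: l₂) h
    have h2 : vsize x < vsize (l a) := vsize_lt_of_mem (by rw [h]; simp)
    rw [vsize_prod, vsize_prod]
    omega
  · have := hout a (l a) [] (by simp)
    omega

theorem reverse {f : α → List β} (hf : CompW W f) : CompW W (fun a => (f a).reverse) := by
  refine (show Poly (fun l : List β => l.reverse) from ?_).poly_comp hf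
  have h := foldl_poly (W := fun l : List β => vsize l) (step := fun _ acc (x : β) => x :: acc)
    (l := fun l : List β => l)
    (b := fun _ => []) (B := fun l => vsize l) (cons snd.snd' snd.fst') id (const _) (.refl _)
    (.refl _) fun l l₁ l₂ hl => by
      have := vsize_append l₁ l₂
      rw [foldl_flip_cons, List.append_nil, vsize_reverse, hl]
      have := one_le_vsize l₂
      omega
  simpa only [foldl_flip_cons, List.append_nil] using h

theorem append {f g : α → List β} (hf : CompW W f) (hg : CompW W g) :
    CompW W (fun a => f a ++ g a) := by
  refine (show Poly (fun p : List β × List β => p.1 ++ p.2) from ?_).poly_comp (hf.pair hg)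
  have h := foldl_poly (W := fun p : List β × List β => vsize p)
    (step := fun _ acc (x : β) => x :: acc)
    (l := fun p : List β × List β => p.1.reverse)
    (b := fun p => p.2) (B := fun p => vsize p) (cons snd.snd' snd.fst') (reverse fst) snd (.refl _)
    (.refl _) fun p l₁ l₂ hl => by
      have h1 := vsize_append l₁.reverse p.2
      have h2 := vsize_append l₁ l₂
      have h3 := one_le_vsize l₂
      obtain ⟨u, v⟩ := p
      have h4 := vsize_reverse u
      rw [vsize_reverse] at h1
      rw [foldl_flip_cons, vsize_prod]
      rw [← hl] at h2
      dsimp only at *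
      omega
  simpa only [foldl_flip_cons, List.reverse_reverse] using h

/-- The weight `V` of one application is kept separate from the size of the argument, because a
group can be exponentially larger than the chunk it comes from. The program folds by consing and
then reverses. -/
theorem map {f : α → γ → δ} {l : α → List γ} {V : α × γ → ℕ} {B : α → ℕ}
    (hf : CompW V (fun p : α × γ => f p.1 p.2)) (hl : CompW W l)
    (ha : PolyLE (fun a => vsize a) W) (hB : PolyLE B W) (hV : ∀ a, ∀ x ∈ l a, V (a, x) ≤ B a) :
    CompW W (fun a => (l a).map (f a)) := by
  obtain ⟨c, hc⟩ := hf.size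
  have hc' : ∀ a, ∀ x ∈ l a, vsize (f a x) ≤ (B a + 2) ^ c := fun a x hx =>
    (hc (a, x)).trans (Nat.pow_le_pow_left (Nat.add_le_add_right (hV a x hx) 2) c)
  have hstate : ∀ a l₁ l₂, l a = l₁ ++ l₂ → vsize (l₁.foldl (fun acc x => f a x :: acc) []) ≤
      vsize (l a) * ((B a + 2) ^ c + 1) + 1 := by
    intro a l₁ l₂ h
    have h1 : l₁.foldl (fun acc x => f a x :: acc) [] = (l₁.map (f a)).reverse := by
      have := foldl_flip_cons (l₁.map (f a)) []
      rwa [List.foldl_map, List.append_nil] at this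
    rw [h1, vsize_reverse]
    refine (vsize_list_le (B := (B a + 2) ^ c) ?_).trans ?_
    · simp only [List.mem_map]
      rintro _ ⟨x, hx, rfl⟩
      exact hc' a x (by rw [h]; simp [hx])
    · refine Nat.add_le_add_right (Nat.mul_le_mul_right _ ?_) 1
      have := length_lt_vsize (l a)
      rw [h, List.length_append] at this
      rw [List.length_map, h]
      omega
  have hD : PolyLE (fun a => vsize (l a) * ((B a + 2) ^ c + 1) + 1) W :=
    (hl.size.mul (((hB.add (.const 2)).pow c).add (.const 1))).add (.const 1)
  have h := foldl (step := fun a acc x => f a x :: acc) (l := l) (b := fun _ => [])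
    -- Each step evaluates `f`, at a cost governed by `V`, and handles the accumulator, at a cost
    -- governed by its size.
    (V := fun p => V (p.1, p.2.2) + vsize p)
    (B := fun a => B a + (vsize a + (vsize (l a) * ((B a + 2) ^ c + 1) + 1) + vsize (l a) + 2))
    (cons (hf.comp ((fst.pair snd.snd').mono (PolyLE.le fun p => by omega))
      (PolyLE.le fun p => by omega))
      ((snd.fst').mono (PolyLE.le fun p => by omega)))
    hl (const _) ha (hB.add (((ha.add hD).add hl.size).add (.const 2)))
    (fun a l₁ x l₂ h => by
      have h1 := hstate a l₁ (x :: l₂) h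
      have hx : x ∈ l a := by rw [h]; simp
      have h2 := hV a x hx
      have h3 := vsize_lt_of_mem hx
      simp only [vsize_prod]
      omega)
    (fun a => by
      have h1 := hstate a (l a) [] (by simp)
      omega)
  have h' := reverse h
  have heq : ∀ a, ((l a).foldl (fun acc x => f a x :: acc) []).reverse = (l a).map (f a) := by
    intro a
    have := foldl_flip_cons ((l a).map (f a)) []
    rw [List.foldl_map, List.append_nil] at this
    rw [this, List.reverse_reverse]
  simpa only [heq] using h'

theorem map_poly {f : α → γ → δ} {l : α → List γ} (hf : Poly (fun p : α × γ => f p.1 p.2))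
    (hl : CompW W l) (ha : PolyLE (fun a => vsize a) W) :
    CompW W (fun a => (l a).map (f a)) :=
  map (B := fun a => vsize a + vsize (l a) + 1) hf hl ha ((ha.add hl.size).add (.const 1))
    fun a x hx => by
      have := vsize_lt_of_mem hx
      rw [vsize_prod]
      omega

theorem flatten {f : α → List (List β)} (hf : CompW W f) : CompW W (fun a => (f a).flatten) := by
  refine (show Poly (fun l : List (List β) => l.flatten) from ?_).poly_comp hf
  have heq : ∀ l : List (List β), l.foldl (fun acc x => x ++ acc) [] = l.reverse.flatten := by
    intro l
    induction l using List.reverseRecOn with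
    | nil => rfl
    | append_singleton l x ih => simp [List.foldl_append, ih]
  have h := foldl_poly (W := fun l : List (List β) => vsize l)
    (step := fun _ acc (x : List β) => x ++ acc) (l := fun l : List (List β) => l.reverse)
    (b := fun _ => []) (B := fun l => vsize l) (append snd.snd' snd.fst') (reverse id) (const _)
    (.refl _) (.refl _) fun l l₁ l₂ hl => by
      have h2 := vsize_append l₁ l₂
      have h3 := one_le_vsize l₂
      have h4 := vsize_flatten_le l₁.reverse
      rw [vsize_reverse] at h4
      rw [← hl, vsize_reverse] at h2
      rw [heq]
      omega
  simpa only [heq, List.reverse_reverse] using h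

theorem flatMap_poly {f : α → γ → List δ} {l : α → List γ}
    (hf : Poly (fun p : α × γ => f p.1 p.2)) (hl : CompW W l)
    (ha : PolyLE (fun a => vsize a) W) : CompW W (fun a => (l a).flatMap (f a)) := by
  have := flatten (map_poly hf hl ha)
  simpa only [List.flatMap_def] using this

theorem length {f : α → List β} (hf : CompW W f) : CompW W (fun a => (f a).length) := by
  have h : Poly (fun l : List β => l.map fun _ => ()) :=
    map_poly (f := fun _ _ => ()) (const _) id (.refl _)
  have h' : Poly (fun l : List Unit => l.length) := cast fun l => by
    rw [toVal_nat_eq]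
    congr 1
    exact (List.eq_replicate_of_mem fun _ _ => rfl).symm
  have := h'.poly_comp (h.poly_comp hf)
  simpa only [List.length_map] using this

theorem replicate_unit {f : α → ℕ} (hf : CompW W f) :
    CompW W (fun a => List.replicate (f a) ()) :=
  (show Poly (fun n : ℕ => List.replicate n ()) from
    cast fun n => (toVal_nat_eq n).symm).poly_comp hf

theorem succ {f : α → ℕ} (hf : CompW W f) : CompW W (fun a => f a + 1) := by
  have := length (cons (const ()) (replicate_unit hf))
  simpa only [List.length_cons, List.length_replicate] using this

theorem pred {f : α → ℕ} (hf : CompW W f) : CompW W (fun a => f a - 1) := by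
  have := length (tail (replicate_unit hf))
  simpa only [List.length_tail, List.length_replicate] using this

theorem natLE {f g : α → ℕ} (hf : CompW W f) (hg : CompW W g) :
    CompW W (fun a => decide (f a ≤ g a)) := by
  refine (show Poly (fun p : ℕ × ℕ => decide (p.1 ≤ p.2)) from ?_).poly_comp (hf.pair hg)
  -- In unary, `m ≤ n` means that removing `n` leaves from a list of `m` leaves empties it.
  have heq : ∀ m (l : List Unit), (List.replicate m ()).foldl (fun l _ => l.tail) l = l.drop m := by
    intro m
    induction m with
    | zero => intro l; rfl
    | succ m ih => intro l; rw [List.replicate_succ, List.foldl_cons, ih]; simp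
  have h := isEmpty <| foldl_poly (W := fun p : ℕ × ℕ => vsize p)
    (step := fun _ (l : List Unit) (_ : Unit) => l.tail)
    (l := fun p => List.replicate p.2 ()) (b := fun p => List.replicate p.1 ())
    (B := fun p => vsize p) (tail snd.fst') (replicate_unit snd) (replicate_unit fst) (.refl _)
    (.refl _) fun p l₁ l₂ hl => by
      have h1 : ∀ (l₁ l : List Unit), vsize (l₁.foldl (fun l _ => l.tail) l) ≤ vsize l := by
        intro l₁
        induction l₁ with
        | nil => intro l; rfl
        | cons x l₁ ih => intro l; exact (ih _).trans (vsize_tail_le l)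
      obtain ⟨m, n⟩ := p
      refine (h1 _ _).trans ?_
      have : vsize (List.replicate m ()) = vsize m := by
        unfold vsize; rw [toVal_nat_eq]
      rw [vsize_prod, this]
      omega
  refine (funext fun p => ?_ : (fun p : ℕ × ℕ => decide (p.1 ≤ p.2)) = _) ▸ h
  rw [heq]
  by_cases hp : p.1 ≤ p.2
  · simp [hp]
  · simp [hp]; omega

theorem and {f g : α → Bool} (hf : CompW W f) (hg : CompW W g) :
    CompW W (fun a => f a && g a) := by
  have h : CompW W (fun a => if f a then g a else false) := hf.ite hg (const false)
  refine (funext fun a => ?_ : (fun a => f a && g a) = _) ▸ h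
  cases f a <;> rfl

theorem xor {f g : α → Bool} (hf : CompW W f) (hg : CompW W g) :
    CompW W (fun a => f a ^^ g a) := by
  have h : CompW W (fun a => if f a then (if g a then false else true) else g a) :=
    hf.ite (hg.ite (const false) (const true)) hg
  refine (funext fun a => ?_ : (fun a => f a ^^ g a) = _) ▸ h
  cases f a <;> cases g a <;> rfl

theorem natEq {f g : α → ℕ} (hf : CompW W f) (hg : CompW W g) :
    CompW W (fun a => f a == g a) := by
  refine (funext fun a => ?_ : (fun a => f a == g a) = _) ▸ (natLE hf hg).and (natLE hg hf)
  rw [Bool.eq_iff_iff]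
  simp only [beq_iff_eq, Bool.and_eq_true, decide_eq_true_eq]
  omega

theorem boolEq {f g : α → Bool} (hf : CompW W f) (hg : CompW W g) :
    CompW W (fun a => f a == g a) := by
  have h : CompW W (fun a => if f a then g a else (if g a then false else true)) :=
    hf.ite hg (hg.ite (const false) (const true))
  refine (funext fun a => ?_ : (fun a => f a == g a) = _) ▸ h
  cases f a <;> cases g a <;> rfl

theorem zipIdx {f : α → List β} (hf : CompW W f) : CompW W (fun a => (f a).zipIdx) := by
  refine (show Poly (fun l : List β => l.zipIdx) from ?_).poly_comp hf
  have heq : ∀ (l : List β), l.foldl (fun (s : ℕ × List (β × ℕ)) x => (s.1 + 1, (x, s.1) :: s.2))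
      (0, []) = (l.length, l.zipIdx.reverse) := by
    intro l
    induction l using List.reverseRecOn with
    | nil => rfl
    | append_singleton l x ih => simp [List.foldl_append, ih, List.zipIdx_append]
  have h := foldl_poly (W := fun l : List β => vsize l)
    (step := fun _ (s : ℕ × List (β × ℕ)) (x : β) => (s.1 + 1, (x, s.1) :: s.2))
    (l := fun l : List β => l) (b := fun _ => (0, []))
    (B := fun l => 2 * vsize l + 1 + (vsize l * (3 * vsize l + 3) + 1) + 1)
    (pair (succ snd.fst'.fst') (cons (pair snd.snd' snd.fst'.fst') snd.fst'.snd')) id (const _)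
    (.refl _) (((((PolyLE.const 2).mul (.refl _)).add (.const 1)).add (((PolyLE.refl _).mul
      (((PolyLE.const 3).mul (.refl _)).add (.const 3))).add (.const 1))).add (.const 1))
    fun l l₁ l₂ hl => by
      have hlen : l₁.length ≤ vsize l := by
        have := length_lt_vsize l
        rw [hl, List.length_append] at this
        rw [hl]
        omega
      rw [heq, vsize_prod, vsize_nat, vsize_reverse]
      have h1 : vsize l₁.zipIdx ≤ l₁.zipIdx.length * ((3 * vsize l + 2) + 1) + 1 := by
        refine vsize_list_le fun p hp => ?_
        obtain ⟨x, i⟩ := p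
        rw [vsize_prod, vsize_nat]
        obtain ⟨-, hi, hx⟩ := List.mem_zipIdx hp
        have h3 : vsize x < vsize l := vsize_lt_of_mem (by rw [hl, hx]; simp)
        omega
      rw [List.length_zipIdx] at h1
      have h2 : l₁.length * ((3 * vsize l + 2) + 1) ≤ vsize l * (3 * vsize l + 3) :=
        Nat.mul_le_mul_right _ hlen
      omega
  have h' := reverse h.snd'
  simpa only [heq, List.reverse_reverse] using h'

theorem range {f : α → ℕ} (hf : CompW W f) : CompW W (fun a => List.range (f a)) := by
  refine (show Poly (fun n : ℕ => List.range n) from ?_).poly_comp hf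
  have h : Poly (fun n : ℕ => ((List.replicate n ()).zipIdx).map Prod.snd) :=
    map_poly (f := fun _ (p : Unit × ℕ) => p.2) snd.snd' (zipIdx (replicate_unit id)) (.refl _)
  refine (funext fun n => ?_ : (fun n : ℕ => List.range n) = _) ▸ h
  rw [List.zipIdx_map_snd]
  simp [List.range_eq_range']

end CompW

end WhileLang

namespace WhileLang

open scoped Pointwise

/-! ### Chunks of sizes `1, 2, 3, …` -/

/-- One step of the division of a list into chunks: the chunks so far (the current one first), the
number of free places in the current chunk, and the number of chunks. -/
def chunkStep {α : Type} (s : List (List α) × ℕ × ℕ) (x : α) : List (List α) × ℕ × ℕ :=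
  if s.2.1 == 0 then ([x] :: s.1, s.2.2, s.2.2 + 1)
  else ((x :: s.1.headD []) :: s.1.tail, s.2.1 - 1, s.2.2)

/-- The chunks of a list, with the numbers of free places and of chunks. -/
def chunkState {α : Type} (l : List α) : List (List α) × ℕ × ℕ :=
  l.foldl chunkStep ([], 0, 0)

/-- The division of a list into chunks of sizes `1, 2, 3, …`; the last chunk may be smaller. -/
def chunks {α : Type} (l : List α) : List (List α) := (chunkState l).1

section Chunks

variable {α : Type}

theorem chunkState_append_singleton (l : List α) (x : α) :
    chunkState (l ++ [x]) = chunkStep (chunkState l) x := by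
  simp [chunkState, List.foldl_append]

/-- The invariant of the greedy division. Chunks of sizes `1, …, m` have total capacity `m * (m + 1)
/ 2`, of which `r` places are free, all in the newest chunk. Growing sizes balance the number of
chunks against their length without computing a square root. -/
theorem chunkState_spec (l : List α) : ∃ cs r m, chunkState l = (cs, r, m) ∧
    cs.flatten.Perm l ∧ cs.length = m ∧ 2 * (l.length + r) = m * (m + 1) ∧
    (cs = [] ∧ r = 0 ∨ ∃ c cs', cs = c :: cs' ∧ c.length + r = m ∧ r < m ∧
      (∀ c' ∈ cs', c'.length < m) ∧ (2 ≤ m → ∃ c' ∈ cs', c'.length + 1 = m)) := by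
  induction l using List.reverseRecOn with
  | nil => exact ⟨[], 0, 0, rfl, .refl _, rfl, rfl, .inl ⟨rfl, rfl⟩⟩
  | append_singleton l x ih =>
    obtain ⟨cs, r, m, h, hp, hm, hl, hc⟩ := ih
    rw [chunkState_append_singleton, h]
    rcases Nat.eq_zero_or_pos r with rfl | hr
    -- The newest chunk is full. The next one has capacity `m + 1`, and its first element leaves `m`
    -- places free.
    · refine ⟨[x] :: cs, m, m + 1, rfl, ?_, by simp [hm], ?_, .inr ⟨[x], cs, rfl, ?_, ?_, ?_, ?_⟩⟩
      · simpa using (hp.cons x).trans (List.perm_append_singleton x l).symm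
      · rw [List.length_append, List.length_singleton]; nlinarith
      · simp; omega
      · omega
      · rcases hc with ⟨rfl, -⟩ | ⟨c, cs', rfl, h1, h2, h3, h4⟩
        · simp
        · intro c' hc'
          rcases List.mem_cons.1 hc' with rfl | hc'
          · omega
          · have := h3 c' hc'; omega
      · intro h2
        rcases hc with ⟨rfl, -⟩ | ⟨c, cs', rfl, h1, h2, h3, h4⟩
        · simp at hm; omega
        · exact ⟨c, List.mem_cons_self, by omega⟩
    · rcases hc with ⟨-, h0⟩ | ⟨c, cs', rfl, h1, h2, h3, h4⟩
      · omega
      have hstep : chunkStep (c :: cs', r, m) x = ((x :: c) :: cs', r - 1, m) := by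
        simp [chunkStep, hr.ne']
      refine ⟨_, _, _, hstep, ?_, by simpa using hm, ?_, .inr ⟨_, _, rfl, ?_, by omega, h3, h4⟩⟩
      · simpa using (hp.cons x).trans (List.perm_append_singleton x l).symm
      · rw [List.length_append, List.length_singleton, ← hl]; omega
      · rw [List.length_cons]; omega

theorem flatten_chunks_perm (l : List α) : (chunks l).flatten.Perm l := by
  obtain ⟨cs, r, m, h, hp, -⟩ := chunkState_spec l
  rwa [chunks, h]

theorem length_le_of_mem_chunks {l : List α} {c : List α} (hc : c ∈ chunks l) :
    c.length ≤ (chunks l).length := by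
  obtain ⟨cs, r, m, h, -, hm, -, h1⟩ := chunkState_spec l
  rw [chunks, h] at hc ⊢
  rcases h1 with ⟨rfl, -⟩ | ⟨c', cs', rfl, h1, h2, h3, -⟩
  · simp at hc
  · dsimp only at *
    rw [hm]
    rcases List.mem_cons.1 hc with rfl | hc
    · omega
    · exact (h3 c hc).le

/-- With `m ≥ 2` chunks, one of them has `m - 1 ≥ m / 2` elements. Its group has at least `2 ^ (m /
2)` vectors, which yields the lower bound on the input size. -/
theorem exists_mem_chunks {l : List α} (hl : l ≠ []) :
    ∃ c ∈ chunks l, (chunks l).length ≤ 2 * c.length := by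
  obtain ⟨cs, r, m, h, hp, hm, -, h1⟩ := chunkState_spec l
  rw [chunks, h]
  rcases h1 with ⟨rfl, -⟩ | ⟨c', cs', rfl, h1, h2, h3, h4⟩
  · exact absurd (by simpa using hp.symm) hl
  · by_cases h2m : 2 ≤ m
    · obtain ⟨c, hc, hcm⟩ := h4 h2m
      exact ⟨c, List.mem_cons_of_mem _ hc, by dsimp only; omega⟩
    · exact ⟨c', List.mem_cons_self, by dsimp only; omega⟩

theorem length_le_sq_length_chunks (l : List α) : l.length ≤ (chunks l).length ^ 2 := by
  obtain ⟨cs, r, m, h, hp, hm, h1, -⟩ := chunkState_spec l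
  rw [chunks, h]
  dsimp only
  rw [hm]
  have : m ≤ m ^ 2 := Nat.le_self_pow two_ne_zero m
  nlinarith

/-- At most `m - 1` places are free, so `2 * l.length ≥ m ^ 2 - m + 2`. -/
theorem sq_length_chunks_le (l : List α) : (chunks l).length ^ 2 ≤ 4 * l.length := by
  obtain ⟨cs, r, m, h, hp, hm, h1, h2⟩ := chunkState_spec l
  rw [chunks, h]
  dsimp only
  rw [hm]
  rcases h2 with ⟨rfl, -⟩ | ⟨c', cs', rfl, h1, h2, h3, h4⟩
  · simp at hm; simp [← hm]
  · have hlen : 1 ≤ l.length ∨ l.length = 0 := by omega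
    rcases Nat.lt_or_ge m 2 with hm2 | hm2
    · have : m = 1 := by omega
      subst this
      omega
    · nlinarith

end Chunks

/-! ### Groups of vectors from options -/

section Groups

variable {β σ : Type}

/-- All ways to choose one option `(v, b)` for every `v` in the list, with `b` in `vals`. -/
def choices (vals : List β) (ch : List ℕ) : List (List (ℕ × β)) :=
  ch.foldl (fun S v => S.flatMap fun w => vals.map fun b => (v, b) :: w) [[]]

/-- The number, modulo two, of the options `(v, b)` in the list with `key s = v` that pass the test
with the slot `s`. -/
def parity (key : σ → ℕ) (test : β → σ → Bool) (w : List (ℕ × β)) (s : σ) : Bool :=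
  w.foldl (fun acc o => acc ^^ (key s == o.1 && test o.2 s)) false

/-- The vectors given by the choices for a list: one coordinate for every slot. -/
def groupOf (key : σ → ℕ) (test : β → σ → Bool) (vals : List β) (slots : List σ) (ch : List ℕ) :
    List (List Bool) :=
  (choices vals ch).map fun w => slots.map fun s => parity key test w s

variable {key : σ → ℕ} {test : β → σ → Bool} {vals : List β} {slots : List σ} {ch : List ℕ}

theorem choices_nil : choices vals [] = [[]] := rfl

theorem choices_append_singleton (v : ℕ) : choices vals (ch ++ [v]) =
    (choices vals ch).flatMap fun w => vals.map fun b => (v, b) :: w := by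
  simp [choices, List.foldl_append]

theorem parity_cons (o : ℕ × β) (w : List (ℕ × β)) (s : σ) : parity key test (o :: w) s =
    ((key s == o.1 && test o.2 s) ^^ parity key test w s) := by
  have h : ∀ (w : List (ℕ × β)) (b : Bool),
      w.foldl (fun acc o => acc ^^ (key s == o.1 && test o.2 s)) b = (b ^^ parity key test w s) := by
    intro w
    induction w with
    | nil => intro b; simp [parity]
    | cons o w ih =>
      intro b
      rw [parity, List.foldl_cons, List.foldl_cons, ih, ih, Bool.false_xor, Bool.xor_assoc]
  rw [parity, List.foldl_cons, h, Bool.false_xor]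

theorem length_choices : (choices vals ch).length = vals.length ^ ch.length := by
  induction ch using List.reverseRecOn with
  | nil => rfl
  | append_singleton l x ih =>
    simp [choices_append_singleton, List.length_flatMap, ih, pow_succ]

theorem mem_choices {ch : List ℕ} {w : List (ℕ × β)} (hw : w ∈ choices vals ch) :
    w.length = ch.length ∧ ∀ o ∈ w, o.1 ∈ ch ∧ o.2 ∈ vals := by
  induction ch using List.reverseRecOn generalizing w with
  | nil =>
    rw [choices_nil, List.mem_singleton] at hw
    subst hw
    simp
  | append_singleton l x ih =>
    rw [choices_append_singleton] at hw
    obtain ⟨w', hw', hw⟩ := List.mem_flatMap.1 hw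
    obtain ⟨b, hb, rfl⟩ := List.mem_map.1 hw
    obtain ⟨h1, h2⟩ := ih hw'
    refine ⟨by simp [h1], fun o ho => ?_⟩
    rcases List.mem_cons.1 ho with rfl | ho
    · exact ⟨by simp, hb⟩
    · exact ⟨by simp [(h2 o ho).1], (h2 o ho).2⟩

theorem parity_eq_false {w : List (ℕ × β)} (hw : w ∈ choices vals ch) {s : σ} (hs : key s ∉ ch) :
    parity key test w s = false := by
  induction ch using List.reverseRecOn generalizing w with
  | nil =>
    rw [choices_nil, List.mem_singleton] at hw
    subst hw
    rfl
  | append_singleton l x ih =>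
    rw [choices_append_singleton] at hw
    obtain ⟨w', hw', hw⟩ := List.mem_flatMap.1 hw
    obtain ⟨b, hb, rfl⟩ := List.mem_map.1 hw
    simp only [List.mem_append, List.mem_singleton, not_or] at hs
    rw [parity_cons, ih hw' hs.1]
    simp [hs.2]

theorem nodup_choices (hv : vals.Nodup) : (choices vals ch).Nodup := by
  induction ch using List.reverseRecOn with
  | nil => simp [choices_nil]
  | append_singleton l x ih =>
    rw [choices_append_singleton, List.nodup_flatMap]
    refine ⟨fun w _ => hv.map fun b b' h => by simpa using h, ih.imp ?_⟩
    intro w w' hne u hu hu'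
    obtain ⟨b, -, rfl⟩ := List.mem_map.1 hu
    obtain ⟨b', -, h⟩ := List.mem_map.1 hu'
    exact hne (List.cons.inj h).2.symm

/-- At a slot whose key is the last index, only the option chosen for that index contributes. By
`hsep` these slots determine the option; it then cancels, and induction handles the rest. -/
theorem parity_injOn (hch : ch.Nodup)
    (hsep : ∀ v ∈ ch, ∀ b ∈ vals, ∀ b' ∈ vals,
      (∀ s ∈ slots, key s = v → test b s = test b' s) → b = b')
    {w w' : List (ℕ × β)} (hw : w ∈ choices vals ch) (hw' : w' ∈ choices vals ch)
    (h : ∀ s ∈ slots, parity key test w s = parity key test w' s) : w = w' := by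
  induction ch using List.reverseRecOn generalizing w w' with
  | nil =>
    rw [choices_nil, List.mem_singleton] at hw hw'
    rw [hw, hw']
  | append_singleton l x ih =>
    rw [choices_append_singleton] at hw hw'
    obtain ⟨u, hu, hw⟩ := List.mem_flatMap.1 hw
    obtain ⟨b, hb, rfl⟩ := List.mem_map.1 hw
    obtain ⟨u', hu', hw'⟩ := List.mem_flatMap.1 hw'
    obtain ⟨b', hb', rfl⟩ := List.mem_map.1 hw'
    rw [List.nodup_append] at hch
    have hx : x ∉ l := fun hx => hch.2.2 x hx x (by simp) rfl
    simp only [parity_cons] at h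
    obtain rfl : b = b' := by
      refine hsep x (by simp) b hb b' hb' fun s hs hk => ?_
      have h1 := h s hs
      rw [parity_eq_false hu (hk ▸ hx), parity_eq_false hu' (hk ▸ hx)] at h1
      simpa [hk] using h1
    rw [ih hch.1 (fun v hv => hsep v (by simp [hv])) hu hu' fun s hs => by
      have h1 := h s hs
      rwa [Bool.xor_right_inj] at h1]

theorem nodup_groupOf (hv : vals.Nodup) (hch : ch.Nodup)
    (hsep : ∀ v ∈ ch, ∀ b ∈ vals, ∀ b' ∈ vals,
      (∀ s ∈ slots, key s = v → test b s = test b' s) → b = b') :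
    (groupOf key test vals slots ch).Nodup := by
  refine List.Nodup.map_on (fun w hw w' hw' h => ?_) (nodup_choices hv)
  exact parity_injOn hch hsep hw hw' (List.map_inj_left.1 h)

theorem length_of_mem_groupOf {x : List Bool} (hx : x ∈ groupOf key test vals slots ch) :
    x.length = slots.length := by
  obtain ⟨w, -, rfl⟩ := List.mem_map.1 hx
  simp

/-- A list of bits as a vector over the field with two elements. -/
def bitVec (d : ℕ) (l : List Bool) : Fin d → ZMod 2 := fun j => if l.getD j false then 1 else 0

/-- The vector of a single option. -/
def optionVec (key : σ → ℕ) (test : β → σ → Bool) (slots : List σ) (v : ℕ) (b : β) :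
    Fin slots.length → ZMod 2 :=
  fun j => if key slots[j] = v then (if test b slots[j] then 1 else 0) else 0

theorem bitVec_map (f : σ → Bool) (j : Fin slots.length) :
    bitVec slots.length (slots.map f) j = if f slots[j] then 1 else 0 := by
  simp [bitVec, List.getD_eq_getElem?_getD]

/-- The vector of a list of choices is the sum of its option vectors, and the choices are
independent, so the group is a Minkowski sum. -/
theorem setOf_groupOf : {x | ∃ l ∈ groupOf key test vals slots ch, bitVec slots.length l = x} =
    (ch.map fun v => {x | ∃ b ∈ vals, optionVec key test slots v b = x}).sum := by
  induction ch using List.reverseRecOn with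
  | nil =>
    ext x
    simp only [groupOf, choices_nil, List.map_nil, List.sum_nil, Set.mem_zero, List.map_cons,
      List.mem_singleton, exists_eq_left, Set.mem_ofPred_eq]
    have : bitVec slots.length (slots.map fun s => parity key test [] s) = 0 := by
      funext j
      rw [bitVec_map]
      rfl
    rw [this, eq_comm]
  | append_singleton l v ih =>
    rw [List.map_append, List.sum_append, ← ih]
    ext x
    have key_eq : ∀ b w, bitVec slots.length (slots.map fun s => parity key test ((v, b) :: w) s) =
        bitVec slots.length (slots.map fun s => parity key test w s) +
          optionVec key test slots v b := by
      intro b w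
      funext j
      rw [Pi.add_apply, bitVec_map, bitVec_map, parity_cons, optionVec]
      by_cases hk : key slots[j] = v
      · rw [hk]
        cases test b slots[j] <;> cases parity key test w slots[j] <;> simp
        -- The remaining case is `1 + 1 = 0` in `ZMod 2`.
        decide
      · rw [if_neg hk, beq_eq_false_iff_ne.2 hk]
        simp
    simp only [groupOf, choices_append_singleton, List.map_cons, List.map_nil, List.sum_singleton,
      Set.mem_add, Set.mem_ofPred_eq, List.mem_map, List.mem_flatMap]
    constructor
    · rintro ⟨_, ⟨_, ⟨w, hw, b, hb, rfl⟩, rfl⟩, rfl⟩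
      exact ⟨_, ⟨_, ⟨w, hw, rfl⟩, rfl⟩, _, ⟨b, hb, rfl⟩, (key_eq b w).symm⟩
    · rintro ⟨_, ⟨_, ⟨w, hw, rfl⟩, rfl⟩, _, ⟨b, hb, rfl⟩, rfl⟩
      exact ⟨_, ⟨_, ⟨w, hw, b, hb, rfl⟩, rfl⟩, key_eq b w⟩

/-- Minkowski addition is commutative and associative, and the chunks together are a permutation of
the list. -/
theorem sum_setOf_groupOf (l : List ℕ) :
    ((chunks l).map fun ch =>
      {x | ∃ u ∈ groupOf key test vals slots ch, bitVec slots.length u = x}).sum =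
    (l.map fun v => {x | ∃ b ∈ vals, optionVec key test slots v b = x}).sum := by
  simp only [setOf_groupOf]
  rw [← ((flatten_chunks_perm l).map _).sum_eq, List.map_flatten, List.sum_flatten, List.map_map]
  rfl

/-- Coordinate `j` receives a contribution only from the option chosen for the key of its slot. The
lemma serves twice: with variables and truth values, and with clauses and patterns. -/
theorem mem_sum_range_optionVec [Nonempty β] (n : ℕ) (hn : ∀ s ∈ slots, key s < n)
    (x : Fin slots.length → ZMod 2) :
    x ∈ ((List.range n).map fun v => {x | ∃ b ∈ vals, optionVec key test slots v b = x}).sum ↔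
      ∃ a : ℕ → β, (∀ v < n, a v ∈ vals) ∧
        ∀ j : Fin slots.length, x j = if test (a (key slots[j])) slots[j] then 1 else 0 := by
  have hsum : ∀ (a : ℕ → β) (j : Fin slots.length),
      (∑ v ∈ Finset.range n, optionVec key test slots v (a v)) j =
        if test (a (key slots[j])) slots[j] then 1 else 0 := by
    intro a j
    have hj : key slots[j] ∈ Finset.range n := Finset.mem_range.2 (hn _ (List.getElem_mem _))
    rw [Finset.sum_apply]
    simp only [optionVec]
    rw [Finset.sum_ite_eq, if_pos hj]
  change x ∈ ∑ v ∈ Finset.range n, {x | ∃ b ∈ vals, optionVec key test slots v b = x} ↔ _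
  rw [Set.mem_finsetSum]
  constructor
  · rintro ⟨g, hg, rfl⟩
    have hg' : ∀ v, ∃ b : β, v < n → b ∈ vals ∧ optionVec key test slots v b = g v := by
      intro v
      by_cases hv : v < n
      · obtain ⟨b, hb, h⟩ := hg (Finset.mem_range.2 hv)
        exact ⟨b, fun _ => ⟨hb, h⟩⟩
      · exact ⟨Classical.arbitrary β, fun h => absurd h hv⟩
    choose a ha using hg'
    refine ⟨a, fun v hv => (ha v hv).1, fun j => ?_⟩
    rw [← hsum, Finset.sum_congr rfl fun v hv => ((ha v (Finset.mem_range.1 hv)).2).symm]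
  · rintro ⟨a, ha, hx⟩
    refine ⟨fun v => optionVec key test slots v (a v),
      fun {v} hv => ⟨a v, ha v (Finset.mem_range.1 hv), rfl⟩, funext fun j => ?_⟩
    rw [hsum, hx]

end Groups

end WhileLang

namespace WhileLang

open ToVal
open scoped Pointwise

/-! ### Instances given by lists of bits -/

theorem bitVec_injOn {d : ℕ} {l l' : List Bool} (hl : l.length = d) (hl' : l'.length = d)
    (h : bitVec d l = bitVec d l') : l = l' := by
  refine List.ext_getElem (by omega) fun i h1 h2 => ?_
  have := congrFun h ⟨i, by omega⟩
  simp only [bitVec, List.getD_eq_getElem?_getD, List.getElem?_eq_getElem h1,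
    List.getElem?_eq_getElem h2, Option.getD_some] at this
  revert this
  cases l[i] <;> cases l'[i] <;> simp

theorem encodeVec_bitVec {d : ℕ} {l : List Bool} (hl : l.length = d) :
    VectorSumInstance.encodeVec (bitVec d l) = toVal l := by
  subst hl
  unfold VectorSumInstance.encodeVec
  change _ = Val.ofList (l.map Val.ofBool)
  rw [← List.ofFn_getElem_eq_map]
  congr 2
  funext j
  congr 1
  simp only [bitVec, List.getD_eq_getElem?_getD, List.getElem?_eq_getElem j.2, Option.getD_some]
  cases l[j.1] <;> simp

/-- The instance with target zero whose groups are given as lists of bit lists of length `d`. -/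
def instanceOf (d : ℕ) (gs : List (List (List Bool)))
    (h : ∀ g ∈ gs, g.Nodup ∧ ∀ l ∈ g, l.length = d) : VectorSumInstance where
  k := gs.length
  d := d
  group i := gs[i].map (bitVec d)
  group_nodup i := (h _ (List.getElem_mem _)).1.map_on fun _ hl _ hl' he =>
    bitVec_injOn ((h _ (List.getElem_mem _)).2 _ hl) ((h _ (List.getElem_mem _)).2 _ hl') he
  target := 0

section Instance

variable {d : ℕ} {gs : List (List (List Bool))} (h : ∀ g ∈ gs, g.Nodup ∧ ∀ l ∈ g, l.length = d)

theorem encode_instanceOf : (instanceOf d gs h).encode = toVal (gs, List.replicate d false) := by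
  have h1 : (fun i : Fin gs.length => Val.ofList (((instanceOf d gs h).group i).map
      VectorSumInstance.encodeVec)) = fun i : Fin gs.length => toVal gs[i.1] := by
    funext i
    change Val.ofList ((gs[i.1].map (bitVec d)).map (VectorSumInstance.encodeVec (d := d))) =
      Val.ofList (gs[i.1].map toVal)
    rw [List.map_map]
    congr 1
    exact List.map_congr_left fun l hl => encodeVec_bitVec ((h _ (List.getElem_mem _)).2 l hl)
  have h2 : (instanceOf d gs h).target = bitVec d (List.replicate d false) := by
    funext j
    simp [bitVec, instanceOf, List.getD_eq_getElem?_getD]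
    rfl
  unfold VectorSumInstance.encode
  rw [h2, toVal_prod]
  refine congrArg₂ Val.cons ?_ (encodeVec_bitVec (List.length_replicate ..))
  change Val.ofList (List.ofFn fun i : Fin gs.length => _) = _
  rw [h1, List.ofFn_getElem_eq_map gs toVal]
  rfl

theorem hasSolution_instanceOf : (instanceOf d gs h).HasSolution ↔
    (0 : Fin d → ZMod 2) ∈ (gs.map fun g => {x | ∃ l ∈ g, bitVec d l = x}).sum := by
  rw [← List.ofFn_getElem_eq_map, List.sum_ofFn, Set.mem_fintype_sum]
  unfold VectorSumInstance.HasSolution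
  change (∃ v : Fin gs.length → (Fin d → ZMod 2), (∀ i, v i ∈ gs[i].map (bitVec d)) ∧
    ∑ i, v i = 0) ↔ _
  simp only [List.mem_map, Set.mem_ofPred_eq, exists_prop, Fin.getElem_fin]

end Instance

/-! ### The reduction -/

/-- A coordinate of the vectors: a position in a clause with three literals. It consists of the
index of the clause, the position as a unit vector, and the literal. -/
abbrev Slot : Type := ℕ × (Bool × Bool × Bool) × (Bool × ℕ)

/-- A clause with exactly three literals. -/
abbrev Clause3 : Type := (Bool × ℕ) × (Bool × ℕ) × (Bool × ℕ)

/-- A clause with at most three literals, padded to three literals by its first literal. -/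
def padClause (c : List (Bool × ℕ)) : Clause3 :=
  (c.headD (true, 0), c.tail.headD (c.headD (true, 0)), c.tail.tail.headD (c.headD (true, 0)))

/-- The padded clauses, and for every variable a tautological clause that contains it. -/
def paddedClauses (p : ℕ × List (List (Bool × ℕ))) : List Clause3 :=
  p.2.map padClause ++ (List.range p.1).map fun v => ((true, v), (false, v), (false, v))

/-- The three slots of a clause with a given index. -/
def clauseSlots (c : Clause3 × ℕ) : List Slot :=
  [(c.2, (true, false, false), c.1.1), (c.2, (false, true, false), c.1.2.1),
    (c.2, (false, false, true), c.1.2.2)]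

/-- The slots of a list of clauses. -/
def slotsOf (cs : List Clause3) : List Slot := cs.zipIdx.flatMap clauseSlots

/-- The nonzero bit triples: the ways to make a clause with three literals true. -/
def patterns : List (Bool × Bool × Bool) :=
  [(true, true, true), (true, true, false), (true, false, true), (true, false, false),
    (false, true, true), (false, true, false), (false, false, true)]

/-- The variable in a slot. -/
def varKey (s : Slot) : ℕ := s.2.2.2

/-- The value `b` makes the literal in the slot true. -/
def varTest (b : Bool) (s : Slot) : Bool := s.2.2.1 == b

/-- The clause of a slot. -/
def clauseKey (s : Slot) : ℕ := s.1

/-- The bit of a pattern at the position of the slot. -/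
def clauseTest (q : Bool × Bool × Bool) (s : Slot) : Bool :=
  (q.1 && s.2.1.1) ^^ ((q.2.1 && s.2.1.2.1) ^^ (q.2.2 && s.2.1.2.2))

/-- The groups for `n` variables and the given clauses. -/
def vectorGroups (n : ℕ) (cs : List Clause3) : List (List (List Bool)) :=
  (chunks (List.range n)).map (groupOf varKey varTest [true, false] (slotsOf cs)) ++
  (chunks (List.range cs.length)).map (groupOf clauseKey clauseTest patterns (slotsOf cs))

theorem mem_patterns {q : Bool × Bool × Bool} : q ∈ patterns ↔ q ≠ (false, false, false) := by
  obtain ⟨_ | _, _ | _, _ | _⟩ := q <;> simp [patterns]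

/-! ### Correctness of the reduction -/

section Correctness

variable {n : ℕ} {cs : List Clause3}

theorem length_slotsOf : (slotsOf cs).length = 3 * cs.length := by
  simp [slotsOf, List.length_flatMap, clauseSlots, mul_comm]

theorem mem_slotsOf {s : Slot} : s ∈ slotsOf cs ↔
    ∃ i, ∃ hi : i < cs.length, s ∈ clauseSlots (cs[i], i) := by
  unfold slotsOf
  rw [List.mem_flatMap]
  constructor
  · rintro ⟨⟨c, i⟩, h, hs⟩
    obtain ⟨-, hi, hc⟩ := List.mem_zipIdx h
    simp only [Nat.sub_zero] at hc
    exact ⟨i, by omega, hc ▸ hs⟩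
  · rintro ⟨i, hi, hs⟩
    exact ⟨(cs[i], i), List.mem_zipIdx_iff_getElem?.2 (by simp [hi]), hs⟩

theorem clauseKey_lt {s : Slot} (hs : s ∈ slotsOf cs) : clauseKey s < cs.length := by
  obtain ⟨i, hi, hs⟩ := mem_slotsOf.1 hs
  simp only [clauseSlots, List.mem_cons, List.not_mem_nil, or_false] at hs
  rcases hs with rfl | rfl | rfl <;> exact hi

/-- All variables of the clauses are below `n`, and all those variables occur. -/
def VarsExactly (n : ℕ) (cs : List Clause3) : Prop :=
  (∀ c ∈ cs, c.1.2 < n ∧ c.2.1.2 < n ∧ c.2.2.2 < n) ∧ ∀ v < n, ∃ c ∈ cs, c.1.2 = v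

theorem varKey_lt (h : VarsExactly n cs) {s : Slot} (hs : s ∈ slotsOf cs) : varKey s < n := by
  obtain ⟨i, hi, hs⟩ := mem_slotsOf.1 hs
  obtain ⟨h1, h2, h3⟩ := h.1 _ (List.getElem_mem hi)
  simp only [clauseSlots, List.mem_cons, List.not_mem_nil, or_false] at hs
  rcases hs with rfl | rfl | rfl <;> assumption

theorem nodup_of_mem_chunks {m : ℕ} {ch : List ℕ} (h : ch ∈ chunks (List.range m)) :
    ch.Nodup ∧ ∀ v ∈ ch, v < m := by
  have hp := flatten_chunks_perm (List.range m)
  refine ⟨(List.nodup_flatten.1 (hp.nodup_iff.2 List.nodup_range)).1 ch h, fun v hv => ?_⟩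
  exact List.mem_range.1 (hp.mem_iff.1 (List.mem_flatten.2 ⟨ch, h, hv⟩))

/-- The groups must list distinct vectors. A truth value is recovered from any slot of its variable,
hence the requirement that every variable occur; a pattern is recovered from the three slots of its
clause. -/
theorem vectorGroups_spec (h : VarsExactly n cs) :
    ∀ g ∈ vectorGroups n cs, g.Nodup ∧ ∀ l ∈ g, l.length = (slotsOf cs).length := by
  intro g hg
  unfold vectorGroups at hg
  rcases List.mem_append.1 hg with hg | hg
  · obtain ⟨ch, hch, rfl⟩ := List.mem_map.1 hg
    obtain ⟨h1, h2⟩ := nodup_of_mem_chunks hch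
    refine ⟨nodup_groupOf (by simp) h1 fun v hv b _ b' _ hb => ?_,
      fun l hl => length_of_mem_groupOf hl⟩
    obtain ⟨c, hc, hcv⟩ := h.2 v (h2 v hv)
    obtain ⟨i, hi, rfl⟩ := List.getElem_of_mem hc
    have := hb (i, (true, false, false), cs[i].1) (mem_slotsOf.2 ⟨i, hi, by simp [clauseSlots]⟩) hcv
    simp only [varTest] at this
    revert this
    cases cs[i].1.1 <;> cases b <;> cases b' <;> simp
  · obtain ⟨ch, hch, rfl⟩ := List.mem_map.1 hg
    obtain ⟨h1, h2⟩ := nodup_of_mem_chunks hch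
    refine ⟨nodup_groupOf (by decide) h1 fun i hi q _ q' _ hq => ?_,
      fun l hl => length_of_mem_groupOf hl⟩
    have hi' := h2 i hi
    have e1 := hq _ (mem_slotsOf.2 ⟨i, hi', by simp [clauseSlots]; exact .inl rfl⟩) rfl
    have e2 := hq _ (mem_slotsOf.2 ⟨i, hi', by simp [clauseSlots]; exact .inr (.inl rfl)⟩) rfl
    have e3 := hq _ (mem_slotsOf.2 ⟨i, hi', by simp [clauseSlots]; exact .inr (.inr rfl)⟩) rfl
    obtain ⟨q1, q2, q3⟩ := q
    obtain ⟨q1', q2', q3'⟩ := q'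
    simp [clauseTest] at e1 e2 e3
    rw [e1, e2, e3]

/-- The truth value of a literal. -/
def litValue (a : ℕ → Bool) (l : Bool × ℕ) : Bool := l.1 == a l.2

/-- In characteristic two, the two partial sums cancel iff the literal values agree with the
patterns at every slot. Nonzero patterns then say that every clause has a true literal. -/
theorem zero_mem_sum_vectorGroups (h : VarsExactly n cs) :
    (0 : Fin (slotsOf cs).length → ZMod 2) ∈ ((vectorGroups n cs).map
      fun g => {x | ∃ l ∈ g, bitVec (slotsOf cs).length l = x}).sum ↔
    ∃ a : ℕ → Bool, ∀ c ∈ cs, litValue a c.1 ∨ litValue a c.2.1 ∨ litValue a c.2.2 := by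
  unfold vectorGroups
  rw [List.map_append, List.sum_append, List.map_map, List.map_map]
  change _ ∈ ((chunks (List.range n)).map fun ch => {x | ∃ u ∈ groupOf varKey varTest
    [true, false] (slotsOf cs) ch, bitVec _ u = x}).sum + ((chunks (List.range cs.length)).map
    fun ch => {x | ∃ u ∈ groupOf clauseKey clauseTest patterns (slotsOf cs) ch,
      bitVec _ u = x}).sum ↔ _
  rw [sum_setOf_groupOf, sum_setOf_groupOf, Set.mem_add]
  simp only [mem_sum_range_optionVec n fun s hs => varKey_lt h hs,
    mem_sum_range_optionVec cs.length fun s hs => clauseKey_lt hs]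
  have hslot : ∀ (x y : Fin (slotsOf cs).length → ZMod 2) (f g : Slot → Bool),
      (∀ j, x j = if f (slotsOf cs)[j] then 1 else 0) →
      (∀ j, y j = if g (slotsOf cs)[j] then 1 else 0) →
      (x + y = 0 ↔ ∀ s ∈ slotsOf cs, f s = g s) := by
    intro x y f g hx hy
    rw [funext_iff, List.forall_mem_iff_getElem]
    have hxy : ∀ j, (x + y) j = 0 ↔ f (slotsOf cs)[j] = g (slotsOf cs)[j] := by
      intro j
      rw [Pi.add_apply, hx, hy]
      cases f (slotsOf cs)[j] <;> cases g (slotsOf cs)[j] <;> simp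
      decide
    exact ⟨fun H i hi => (hxy ⟨i, hi⟩).1 (H _), fun H j => (hxy j).2 (H j.1 j.2)⟩
  constructor
  · rintro ⟨x, ⟨a, -, hx⟩, y, ⟨q, hq, hy⟩, hxy⟩
    rw [hslot x y (fun s => varTest (a (varKey s)) s) (fun s => clauseTest (q (clauseKey s)) s)
      hx hy] at hxy
    refine ⟨a, fun c hc => ?_⟩
    obtain ⟨i, hi, rfl⟩ := List.getElem_of_mem hc
    have e1 := hxy _ (mem_slotsOf.2 ⟨i, hi, by simp [clauseSlots]; exact .inl rfl⟩)
    have e2 := hxy _ (mem_slotsOf.2 ⟨i, hi, by simp [clauseSlots]; exact .inr (.inl rfl)⟩)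
    have e3 := hxy _ (mem_slotsOf.2 ⟨i, hi, by simp [clauseSlots]; exact .inr (.inr rfl)⟩)
    have hqi := mem_patterns.1 (hq i hi)
    simp only [varTest, varKey, clauseTest, clauseKey, Bool.and_true, Bool.and_false,
      Bool.xor_false, Bool.false_xor] at e1 e2 e3
    unfold litValue
    rw [e1, e2, e3]
    by_contra! hcon
    exact hqi (by ext <;> simp_all)
  · rintro ⟨a, ha⟩
    -- The pattern of a clause consists of the truth values of its literals; the default beyond the
    -- last clause is never used.
    let q : ℕ → Bool × Bool × Bool := fun i => if hi : i < cs.length then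
      (litValue a cs[i].1, litValue a cs[i].2.1, litValue a cs[i].2.2) else (true, true, true)
    refine ⟨fun j => if varTest (a (varKey (slotsOf cs)[j])) (slotsOf cs)[j] then 1 else 0,
      ⟨a, fun v _ => by cases a v <;> simp, fun j => rfl⟩,
      fun j => if clauseTest (q (clauseKey (slotsOf cs)[j])) (slotsOf cs)[j] then 1 else 0,
      ⟨q, fun i hi => ?_, fun j => rfl⟩, ?_⟩
    · rw [mem_patterns]
      have := ha _ (List.getElem_mem hi)
      simp only [q, dif_pos hi]
      intro heq
      simp only [Prod.mk.injEq] at heq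
      simp [heq] at this
    · rw [hslot _ _ (fun s => varTest (a (varKey s)) s)
        (fun s => clauseTest (q (clauseKey s)) s) (fun j => rfl) fun j => rfl]
      intro s hs
      obtain ⟨i, hi, hs⟩ := mem_slotsOf.1 hs
      simp only [clauseSlots, List.mem_cons, List.not_mem_nil, or_false] at hs
      rcases hs with rfl | rfl | rfl <;>
        simp [varTest, varKey, clauseTest, clauseKey, q, hi, litValue]

end Correctness

end WhileLang

namespace WhileLang

open ToVal

/-! ### The running time of the reduction -/

section Choices

variable {β σ : Type} [ToVal β] [ToVal σ] {vals : List β}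

theorem vsize_choices_le (l : List ℕ) : vsize (choices vals l) ≤
    vals.length ^ l.length * (vsize l * (vsize l + vsize vals + 2) + 2) + 1 := by
  have h1 : ∀ w ∈ choices vals l, vsize w ≤ vsize l * (vsize l + vsize vals + 2) + 1 := by
    intro w hw
    obtain ⟨hlen, hmem⟩ := mem_choices hw
    refine (vsize_list_le (B := vsize l + vsize vals + 1) fun o ho => ?_).trans ?_
    · have ha := vsize_lt_of_mem (hmem o ho).1
      have hb := vsize_lt_of_mem (hmem o ho).2
      obtain ⟨i, b⟩ := o
      rw [vsize_prod]
      dsimp only at ha hb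
      omega
    · rw [hlen]
      exact Nat.add_le_add_right (Nat.mul_le_mul_right _ (length_lt_vsize l).le) 1
  have h2 := vsize_list_le h1
  rwa [length_choices] at h2

/-- The weight of a list of indices for the computation of the choices. -/
def choiceWeight (vals : List β) (l : List ℕ) : ℕ := vsize l + vals.length ^ l.length

/-- The intermediate states are the choices for prefixes. Since `vals` is nonempty, the bound of
`vsize_choices_le` is monotone in the list and covers them all. -/
theorem compW_choices (hv : vals ≠ []) :
    CompW (choiceWeight vals) (fun l : List ℕ => choices vals l) := by
  have hvs : PolyLE (fun l : List ℕ => vsize l) (choiceWeight vals) :=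
    PolyLE.le fun l => Nat.le_add_right _ _
  have hpow : PolyLE (fun l : List ℕ => vals.length ^ l.length) (choiceWeight vals) :=
    PolyLE.le fun l => Nat.le_add_left _ _
  have hstep : Poly (fun p : List ℕ × List (List (ℕ × β)) × ℕ =>
      p.2.1.flatMap fun w => vals.map fun b => (p.2.2, b) :: w) :=
    CompW.flatMap_poly (f := fun (p : List ℕ × List (List (ℕ × β)) × ℕ) w =>
        vals.map fun b => (p.2.2, b) :: w)
      (CompW.map_poly (f := fun (q : (List ℕ × List (List (ℕ × β)) × ℕ) × List (ℕ × β)) b =>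
          (q.1.2.2, b) :: q.2)
        (.cons (.pair CompW.fst.fst'.snd'.snd' .snd) CompW.fst.snd') (.const vals) (.refl _))
      CompW.snd.fst' (.refl _)
  refine CompW.foldl_poly (step := fun (_ : List ℕ) (S : List (List (ℕ × β))) (v : ℕ) =>
      S.flatMap fun w => vals.map fun b => (v, b) :: w) (l := fun l : List ℕ => l)
    (B := fun l => vals.length ^ l.length * (vsize l * (vsize l + vsize vals + 2) + 2) + 1)
    hstep (CompW.id.mono hvs) (.const _) hvs
    ((hpow.mul ((hvs.mul ((hvs.add (.const _)).add (.const _))).add (.const _))).add (.const _))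
    fun l l₁ l₂ hl => ?_
  refine (vsize_choices_le l₁).trans ?_
  have h1 : vsize l₁ ≤ vsize l := by
    have := vsize_append l₁ l₂
    have := one_le_vsize l₂
    rw [hl]
    omega
  have h2 : l₁.length ≤ l.length := by simp [hl]
  have h3 : 0 < vals.length := List.length_pos_of_ne_nil hv
  gcongr

theorem poly_parity {key : σ → ℕ} {test : β → σ → Bool} (hkey : Poly key)
    (htest : Poly fun p : β × σ => test p.1 p.2) :
    Poly (fun p : List (ℕ × β) × σ => parity key test p.1 p.2) := by
  refine CompW.foldl_poly
    (step := fun (p : List (ℕ × β) × σ) (acc : Bool) (o : ℕ × β) =>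
      acc ^^ (key p.2 == o.1 && test o.2 p.2)) (B := fun _ => 3)
    (.xor CompW.snd.fst' (.and (.natEq (hkey.poly_comp CompW.fst.snd') CompW.snd.snd'.fst')
      (htest.poly_comp (.pair CompW.snd.snd'.snd' CompW.fst.snd'))))
    .fst (.const _) (.refl _) (.const _) fun _ _ _ _ => vsize_bool_le _

theorem compW_groupOf {key : σ → ℕ} {test : β → σ → Bool} (hv : vals ≠ []) (hkey : Poly key)
    (htest : Poly fun p : β × σ => test p.1 p.2) :
    CompW (fun p => vsize p + vals.length ^ p.2.length)
      (fun p : List σ × List ℕ => groupOf key test vals p.1 p.2) := by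
  have hvs : PolyLE (fun p => vsize p)
      (fun p : List σ × List ℕ => vsize p + vals.length ^ p.2.length) :=
    PolyLE.le fun p => Nat.le_add_right _ _
  refine CompW.map_poly (f := fun (p : List σ × List ℕ) w => p.1.map fun s => parity key test w s)
    (CompW.map_poly (f := fun (q : (List σ × List ℕ) × List (ℕ × β)) s => parity key test q.2 s)
      ((poly_parity hkey htest).poly_comp (.pair CompW.fst.snd' .snd)) CompW.fst.fst' (.refl _))
    ((compW_choices hv).comp (CompW.snd.mono hvs) (PolyLE.le fun p => ?_)) hvs
  have : vsize p = vsize p.1 + vsize p.2 + 1 := rfl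
  unfold choiceWeight
  omega

end Choices

theorem poly_chunks {α : Type} [ToVal α] : Poly (fun l : List α => chunks l) := by
  refine CompW.fst' (f := fun l : List α => chunkState l) ?_
  have hstep : Poly (fun p : List α × (List (List α) × ℕ × ℕ) × α => chunkStep p.2.1 p.2.2) := by
    have hs : Poly (fun p : List α × (List (List α) × ℕ × ℕ) × α => p.2.1) := CompW.snd.fst'
    have hx : Poly (fun p : List α × (List (List α) × ℕ × ℕ) × α => p.2.2) := CompW.snd.snd'
    exact .ite (.natEq hs.snd'.fst' (.const 0))
      (.pair (.cons (.cons hx (.const [])) hs.fst') (.pair hs.snd'.snd' hs.snd'.snd'.succ))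
      (.pair (.cons (.cons hx (.headD hs.fst' (.const []))) hs.fst'.tail)
        (.pair hs.snd'.fst'.pred hs.snd'.snd'))
  refine CompW.foldl_poly (step := fun (_ : List α) => chunkStep) (l := fun l : List α => l)
    (b := fun _ => ([], 0, 0))
    (B := fun l => (2 * vsize l * (vsize l * (vsize l + 1) + 2) + 1) +
      (4 * vsize l + 1 + (4 * vsize l + 1) + 1) + 1)
    hstep .id (.const _) (.refl _)
    ((((((PolyLE.const 2).mul (.refl _)).mul (((PolyLE.refl _).mul ((PolyLE.refl _).add
      (.const 1))).add (.const 2))).add (.const 1)).add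
      (((((PolyLE.const 4).mul (.refl _)).add (.const 1)).add
        (((PolyLE.const 4).mul (.refl _)).add (.const 1))).add (.const 1))).add (.const 1))
    fun l l₁ l₂ hl => ?_
  change vsize (chunkState l₁) ≤ _
  have hlen : l₁.length ≤ vsize l := by
    have := length_lt_vsize l
    rw [hl, List.length_append] at this
    rw [hl]
    omega
  have hm := sq_length_chunks_le l₁
  have hmem : ∀ c ∈ chunks l₁, vsize c ≤ vsize l * (vsize l + 1) + 1 := by
    intro c hc
    have hp := flatten_chunks_perm l₁
    refine (vsize_list_le (B := vsize l) fun x hx => ?_).trans ?_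
    · exact (vsize_lt_of_mem (by
        rw [hl]
        exact List.mem_append_left _ (hp.mem_iff.1 (List.mem_flatten.2 ⟨c, hc, hx⟩)))).le
    · have h1 := (List.sublist_flatten_of_mem hc).length_le
      rw [hp.length_eq] at h1
      exact Nat.add_le_add_right (Nat.mul_le_mul_right _ (h1.trans hlen)) 1
  have h1 := vsize_list_le hmem
  obtain ⟨cs, r, m, h, -, hcm, hlr, hr⟩ := chunkState_spec l₁
  rw [chunks, h] at hm h1
  dsimp only at hm h1
  rw [h, vsize_prod, vsize_prod, vsize_nat, vsize_nat]
  have hrm : r ≤ m := by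
    rcases hr with ⟨-, hr⟩ | ⟨_, _, _, _, hr, _⟩ <;> omega
  -- From `m ^ 2 ≤ 4 * l₁.length ≤ (2 * vsize l) ^ 2`.
  have hm2 : m ≤ 2 * vsize l := by
    rw [hcm] at hm
    have h1 := one_le_vsize l
    nlinarith
  have h2 : cs.length * (vsize l * (vsize l + 1) + 1 + 1) ≤
      2 * vsize l * (vsize l * (vsize l + 1) + 2) := Nat.mul_le_mul_right _ (by omega)
  omega

theorem poly_paddedClauses : Poly paddedClauses := by
  have hpad : Poly padClause :=
    .pair (.headD .id (.const _)) (.pair (.headD CompW.id.tail (.headD .id (.const _)))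
      (.headD CompW.id.tail.tail (.headD .id (.const _))))
  refine .append (.map_poly (f := fun _ c => padClause c) (hpad.poly_comp .snd) .snd (.refl _))
    (.map_poly (f := fun _ (v : ℕ) => ((true, v), (false, v), (false, v)))
      (.pair (.pair (.const _) .snd) (.pair (.pair (.const _) .snd) (.pair (.const _) .snd)))
      (.range .fst) (.refl _))

theorem poly_slotsOf : Poly slotsOf := by
  refine .flatMap_poly (f := fun _ c => clauseSlots c) ?_ (.zipIdx .id) (.refl _)
  have hc : Poly fun p : List Clause3 × (Clause3 × ℕ) => p.2.1 := CompW.snd.fst'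
  have hi : Poly fun p : List Clause3 × (Clause3 × ℕ) => p.2.2 := CompW.snd.snd'
  exact .cons (.pair hi (.pair (.const _) hc.fst'))
    (.cons (.pair hi (.pair (.const _) hc.snd'.fst'))
      (.cons (.pair hi (.pair (.const _) hc.snd'.snd')) (.const _)))

/-- The data of a formula are mapped to the data of an instance of VectorSum. -/
def reduction (p : ℕ × List (List (Bool × ℕ))) : List (List (List Bool)) × List Bool :=
  (vectorGroups p.1 (paddedClauses p), List.replicate (slotsOf (paddedClauses p)).length false)

/-- The weight of a formula for the computation of the reduction. -/
def reductionWeight (p : ℕ × List (List (Bool × ℕ))) : ℕ :=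
  vsize p + (2 ^ (chunks (List.range p.1)).length +
    7 ^ (chunks (List.range (paddedClauses p).length)).length)

/-- No chunk is longer than the number of chunks, so the powers of `2` and `7` in the weight
dominate the number of vectors in any group. -/
theorem compW_reduction : CompW reductionWeight reduction := by
  have hvs : PolyLE (fun p => vsize p) reductionWeight := PolyLE.le fun p => Nat.le_add_right _ _
  have hslots : Poly fun p => slotsOf (paddedClauses p) := poly_slotsOf.poly_comp poly_paddedClauses
  have hgroups : ∀ {β : Type} [ToVal β] (vals : List β) (key : Slot → ℕ) (test : β → Slot → Bool)
      (f : ℕ × List (List (Bool × ℕ)) → ℕ), vals ≠ [] → Poly key →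
      Poly (fun p : β × Slot => test p.1 p.2) → Poly f →
      PolyLE (fun p => vals.length ^ (chunks (List.range (f p))).length) reductionWeight →
      CompW reductionWeight (fun p => (chunks (List.range (f p))).map
        (groupOf key test vals (slotsOf (paddedClauses p)))) := by
    intro β _ vals key test f hv hkey htest hf hpow
    have hchunks : Poly fun p => chunks (List.range (f p)) := poly_chunks.poly_comp (.range hf)
    refine .map (f := fun p => groupOf key test vals (slotsOf (paddedClauses p)))
      (V := fun q => vsize q + vals.length ^ q.2.length)
      (B := fun p => vsize p + vsize (chunks (List.range (f p))) + 1 +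
        vals.length ^ (chunks (List.range (f p))).length)
      ?_ (hchunks.mono hvs) hvs
      (((hvs.add (hchunks.size.trans hvs)).add (.const 1)).add hpow) fun p ch hch => ?_
    · have hpair : Poly fun q : (ℕ × List (List (Bool × ℕ))) × List ℕ =>
          (slotsOf (paddedClauses q.1), q.2) := .pair (hslots.poly_comp .fst) .snd
      have hq : PolyLE (fun q => vsize q) (fun q : (ℕ × List (List (Bool × ℕ))) × List ℕ =>
          vsize q + vals.length ^ q.2.length) := PolyLE.le fun q => Nat.le_add_right _ _
      exact (compW_groupOf hv hkey htest).comp (hpair.mono hq)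
        ((hpair.size.trans hq).add (PolyLE.le fun q => Nat.le_add_left _ _))
    · have h1 := vsize_lt_of_mem hch
      have h2 : vals.length ^ ch.length ≤ vals.length ^ (chunks (List.range (f p))).length :=
        Nat.pow_le_pow_right (List.length_pos_of_ne_nil hv) (length_le_of_mem_chunks hch)
      rw [vsize_prod]
      dsimp only
      omega
  refine .pair (.append ?_ ?_) ?_
  · refine hgroups [true, false] varKey varTest (fun p => p.1) (by simp) CompW.snd.snd'.snd'
      (.boolEq CompW.snd.snd'.snd'.fst' .fst) .fst (PolyLE.le fun p => ?_)
    exact (Nat.le_add_right _ _).trans (Nat.le_add_left _ _)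
  · have hq : Poly fun p : (Bool × Bool × Bool) × Slot => p.1 := .fst
    have hs : Poly fun p : (Bool × Bool × Bool) × Slot => p.2.2.1 := CompW.snd.snd'.fst'
    refine hgroups patterns clauseKey clauseTest (fun p => (paddedClauses p).length) (by decide)
      .fst ?_ poly_paddedClauses.length (PolyLE.le fun p => ?_)
    · exact .xor (.and hq.fst' hs.fst')
        (.xor (.and hq.snd'.fst' hs.snd'.fst') (.and hq.snd'.snd' hs.snd'.snd'))
    · exact (Nat.le_add_left _ _).trans (Nat.le_add_left _ _)
  · have h : Poly fun p => (slotsOf (paddedClauses p)).map fun _ => false :=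
      .map_poly (f := fun _ _ => false) (.const _) hslots (.refl _)
    simpa only [List.map_const'] using h.mono hvs

end WhileLang

namespace WhileLang

open ToVal

/-! ### Formulas as inputs of the reduction -/

/-- The number of variables and the clauses of a formula, with variables as natural numbers. -/
def formulaData (φ : CNF) : ℕ × List (List (Bool × ℕ)) :=
  (φ.numVars, φ.clauses.map fun c => c.map fun l => (l.1, l.2.1))

theorem toVal_formulaData (φ : CNF) : toVal (formulaData φ) = φ.encode := by
  unfold CNF.encode formulaData
  rw [toVal_prod]
  congr 1
  change Val.ofList (List.map (fun c : List (Bool × ℕ) =>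
    Val.ofList (c.map fun l => Val.cons (Val.ofBool l.1) (Val.ofNat l.2))) _) = _
  rw [List.map_map]
  congr 1
  refine List.map_congr_left fun c _ => ?_
  simp only [Function.comp, List.map_map]
  rfl

theorem length_paddedClauses (φ : CNF) :
    (paddedClauses (formulaData φ)).length = φ.clauses.length + φ.numVars := by
  simp [paddedClauses, formulaData]

/-- Double counting: every clause is nonempty, hence counted for at least one variable, and every
variable counts at most three clauses. -/
theorem length_clauses_le {φ : CNF} (h3 : φ.Is3CNF) (ho : φ.AtMostThreeOccurrences) :
    φ.clauses.length ≤ 3 * φ.numVars := by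
  have h : ∀ cs : List (List (Bool × Fin φ.numVars)), (∀ c ∈ cs, 1 ≤ c.length) →
      cs.length ≤ ∑ v, cs.countP (fun c => decide (∃ l ∈ c, l.2 = v)) := by
    intro cs
    induction cs with
    | nil => simp
    | cons c cs ih =>
      intro hc
      have h1 := ih fun c' hc' => hc c' (List.mem_cons_of_mem _ hc')
      have h2 : 1 ≤ ∑ v : Fin φ.numVars, if decide (∃ l ∈ c, l.2 = v) = true then 1 else 0 := by
        obtain ⟨l, hl⟩ := List.exists_mem_of_length_pos (hc c List.mem_cons_self)
        refine le_trans ?_ (Finset.single_le_sum (fun _ _ => Nat.zero_le _) (Finset.mem_univ l.2))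
        rw [if_pos (decide_eq_true ⟨l, hl, rfl⟩)]
      simp only [List.countP_cons, Finset.sum_add_distrib, List.length_cons]
      omega
  refine (h _ fun c hc => (h3 c hc).1).trans ?_
  refine (Finset.sum_le_sum fun v _ => ho v).trans ?_
  simp [mul_comm]

theorem vsize_formulaData_le {φ : CNF} (h3 : φ.Is3CNF) (ho : φ.AtMostThreeOccurrences) :
    vsize (formulaData φ) ≤ 100 * (φ.numVars + 1) ^ 2 := by
  have hlen := length_clauses_le h3 ho
  unfold formulaData
  rw [vsize_prod, vsize_nat]
  have h1 : vsize (φ.clauses.map fun c => c.map fun l => (l.1, l.2.1)) ≤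
      φ.clauses.length * ((3 * (2 * φ.numVars + 6) + 1) + 1) + 1 := by
    have := vsize_list_le (B := 3 * (2 * φ.numVars + 6) + 1)
      (l := φ.clauses.map fun c => c.map fun l => (l.1, l.2.1)) fun c hc => by
        obtain ⟨c', hc', rfl⟩ := List.mem_map.1 hc
        refine (vsize_list_le (B := 2 * φ.numVars + 5) fun l hl => ?_).trans ?_
        · obtain ⟨l, -, rfl⟩ := List.mem_map.1 hl
          rw [vsize_prod, vsize_nat]
          have := vsize_bool_le l.1
          have := l.2.2
          omega
        · rw [List.length_map]
          exact Nat.add_le_add_right (Nat.mul_le_mul_right _ (h3 c' hc').2) 1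
    rwa [List.length_map] at this
  have h2 : φ.clauses.length * ((3 * (2 * φ.numVars + 6) + 1) + 1) ≤
      3 * φ.numVars * ((3 * (2 * φ.numVars + 6) + 1) + 1) := Nat.mul_le_mul_right _ hlen
  nlinarith

/-- The tautological clauses make every variable occur. They also guarantee `N` clauses, and thus a
dimension of at least `3 * N`, however short the formula is. -/
theorem varsExactly_paddedClauses {φ : CNF} (h3 : φ.Is3CNF) :
    VarsExactly φ.numVars (paddedClauses (formulaData φ)) := by
  unfold paddedClauses formulaData
  refine ⟨fun c hc => ?_, fun v hv =>
    ⟨((true, v), (false, v), (false, v)), List.mem_append_right _ (by simpa using hv), rfl⟩⟩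
  rcases List.mem_append.1 hc with hc | hc
  · simp only [List.mem_map, exists_exists_and_eq_and] at hc
    obtain ⟨c', hc', rfl⟩ := hc
    obtain ⟨h1, h2⟩ := h3 c' hc'
    match c', h1, h2 with
    | [x], _, _ => simp [padClause]
    | [x, y], _, _ => simp [padClause]
    | [x, y, z], _, _ => simp [padClause]
  · obtain ⟨v, hv, rfl⟩ := List.mem_map.1 hc
    have := List.mem_range.1 hv
    exact ⟨this, this, this⟩

/-- Repeating a literal does not change a clause, and the added clauses hold under every assignment.
-/
theorem satisfiable_iff {φ : CNF} (h3 : φ.Is3CNF) : φ.Satisfiable ↔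
    ∃ a : ℕ → Bool, ∀ c ∈ paddedClauses (formulaData φ),
      litValue a c.1 ∨ litValue a c.2.1 ∨ litValue a c.2.2 := by
  have hpad : ∀ (a : ℕ → Bool), ∀ c ∈ φ.clauses,
      ((∃ l ∈ c, a l.2.1 = l.1) ↔
        litValue a (padClause (c.map fun l => (l.1, l.2.1))).1 ∨
        litValue a (padClause (c.map fun l => (l.1, l.2.1))).2.1 ∨
        litValue a (padClause (c.map fun l => (l.1, l.2.1))).2.2) := by
    intro a c hc
    obtain ⟨h1, h2⟩ := h3 c hc
    have hlit : ∀ l : Bool × Fin φ.numVars, a l.2.1 = l.1 ↔ litValue a (l.1, l.2.1) = true := by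
      intro l
      rw [litValue, beq_iff_eq, eq_comm]
    simp only [hlit]
    match c, h1, h2 with
    | [x], _, _ => simp [padClause]
    | [x, y], _, _ => simp [padClause]; tauto
    | [x, y, z], _, _ => simp [padClause]
  have htaut : ∀ (a : ℕ → Bool) (v : ℕ), litValue a (true, v) ∨ litValue a (false, v) ∨
      litValue a (false, v) := by
    intro a v
    simp only [litValue]
    cases a v <;> simp
  constructor
  · rintro ⟨a, ha⟩
    refine ⟨fun v => if hv : v < φ.numVars then a ⟨v, hv⟩ else true, fun c hc => ?_⟩
    rcases List.mem_append.1 hc with hc | hc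
    · simp only [formulaData, List.mem_map, exists_exists_and_eq_and] at hc
      obtain ⟨c', hc', rfl⟩ := hc
      rw [← hpad _ c' hc']
      obtain ⟨l, hl, h⟩ := ha c' hc'
      exact ⟨l, hl, by simpa using h⟩
    · obtain ⟨v, -, rfl⟩ := List.mem_map.1 hc
      exact htaut _ v
  · rintro ⟨a, ha⟩
    refine ⟨fun v => a v, fun c hc => (hpad a c hc).2 (ha _ (List.mem_append_left _ ?_))⟩
    simp only [formulaData, List.mem_map, exists_exists_and_eq_and]
    exact ⟨c, hc, rfl⟩

/-- The number of chunks of the variables; its order of magnitude is the square root. -/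
def chunkCount (n : ℕ) : ℕ := (chunks (List.range n)).length

theorem le_sq_chunkCount (n : ℕ) : n ≤ chunkCount n ^ 2 := by
  simpa [chunkCount] using length_le_sq_length_chunks (List.range n)

theorem sq_chunkCount_le (n : ℕ) : chunkCount n ^ 2 ≤ 4 * n := by
  simpa [chunkCount] using sq_length_chunks_le (List.range n)

theorem chunkCount_le_mul {m n : ℕ} (h : m ≤ 4 * n) : chunkCount m ≤ 4 * chunkCount n := by
  have h1 := sq_chunkCount_le m
  have h2 := le_sq_chunkCount n
  refine (Nat.pow_le_pow_iff_left two_ne_zero).1 ?_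
  rw [mul_pow]
  omega

/-- There are at most `4 * N` padded clauses, hence at most `4 * r` clause chunks, and `7 ^ (4 * r)
≤ 2 ^ (12 * r)`. The input size, at most `100 * (N + 1) ^ 2`, is below `100 * 2 ^ (4 * r)`; the
constant `20` leaves room for all factors. -/
theorem reductionWeight_le {φ : CNF} (h3 : φ.Is3CNF) (ho : φ.AtMostThreeOccurrences) :
    reductionWeight (formulaData φ) + 2 ≤ 2 ^ (20 * (chunkCount φ.numVars + 1)) := by
  have hm : chunkCount (paddedClauses (formulaData φ)).length ≤ 4 * chunkCount φ.numVars :=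
    chunkCount_le_mul (by
      rw [length_paddedClauses]
      have := length_clauses_le h3 ho
      omega)
  have h1 := vsize_formulaData_le h3 ho
  unfold reductionWeight
  change _ + (2 ^ chunkCount φ.numVars + 7 ^ chunkCount _) + 2 ≤ _
  have h2 : 7 ^ chunkCount (paddedClauses (formulaData φ)).length ≤
      2 ^ (12 * chunkCount φ.numVars) := by
    calc _ ≤ 8 ^ (4 * chunkCount φ.numVars) :=
          (Nat.pow_le_pow_left (by norm_num) _).trans (Nat.pow_le_pow_right (by norm_num) hm)
      _ = _ := by rw [show 8 = 2 ^ 3 from rfl, ← pow_mul]; ring_nf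
  generalize chunkCount (paddedClauses (formulaData φ)).length = m at *
  have hn := le_sq_chunkCount φ.numVars
  generalize chunkCount φ.numVars = r at *
  have h4 : φ.numVars + 1 ≤ (2 ^ r) ^ 2 := by
    have h5 : r + 1 ≤ 2 ^ r := Nat.lt_two_pow_self
    calc φ.numVars + 1 ≤ (r + 1) ^ 2 := by nlinarith
      _ ≤ _ := Nat.pow_le_pow_left h5 2
  have h5 : (φ.numVars + 1) ^ 2 ≤ (2 ^ r) ^ 4 := by
    calc _ ≤ ((2 ^ r) ^ 2) ^ 2 := Nat.pow_le_pow_left h4 2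
      _ = _ := by ring
  have h6 : (2 ^ r) ^ 4 ≤ 2 ^ (12 * r) := by
    rw [← pow_mul]; exact Nat.pow_le_pow_right (by norm_num) (by omega)
  have h7 : 2 ^ r ≤ 2 ^ (12 * r) := Nat.pow_le_pow_right (by norm_num) (by omega)
  have h8 : 1 ≤ 2 ^ (12 * r) := Nat.one_le_two_pow
  calc _ ≤ 2 ^ 10 * 2 ^ (12 * r) := by omega
    _ ≤ _ := by rw [← pow_add]; exact Nat.pow_le_pow_right (by norm_num) (by omega)

/-- The reduction from 3SAT to VectorSum: the properties of the instance. -/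
theorem exists_reduction : ∃ (q : Prog) (A : ℕ), ∀ φ : CNF, φ.Is3CNF →
    φ.AtMostThreeOccurrences → ∃ (I : VectorSumInstance) (t : ℕ),
      Exec q (initStore φ.encode) t (initStore I.encode) ∧
      t ≤ 2 ^ (A * (chunkCount φ.numVars + 1)) ∧
      I.size ≤ 2 ^ (A * (chunkCount φ.numVars + 1)) ∧
      2 ^ chunkCount φ.numVars ≤ I.size ^ 2 ∧
      chunkCount φ.numVars ≤ I.k ∧ I.k ≤ 5 * chunkCount φ.numVars ∧
      3 * φ.numVars ≤ I.d ∧ I.d ≤ 12 * φ.numVars ∧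
      (I.HasSolution ↔ φ.Satisfiable) := by
  obtain ⟨q, T, ⟨c, hT⟩, ⟨c', hs⟩, hq⟩ := compW_reduction
  -- One constant serves both the running time (exponent `c`) and the output size (exponent `c'`).
  refine ⟨q, 20 * c + 20 * c', fun φ h3 ho => ?_⟩
  have hspec := vectorGroups_spec (varsExactly_paddedClauses h3)
  obtain ⟨t, ht, hexec⟩ := hq (formulaData φ) Val.nil
  have henc : (instanceOf _ _ hspec).encode = toVal (reduction (formulaData φ)) :=
    encode_instanceOf hspec
  have hM := length_clauses_le h3 ho
  have hcs := length_paddedClauses φ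
  have hk : (instanceOf _ _ hspec).k = chunkCount φ.numVars +
      chunkCount (paddedClauses (formulaData φ)).length := by
    change (vectorGroups _ _).length = _
    simp [vectorGroups, chunkCount]
  have hd : (instanceOf _ _ hspec).d = 3 * (paddedClauses (formulaData φ)).length := length_slotsOf
  have hW : ∀ e, e ≤ c + c' → (reductionWeight (formulaData φ) + 2) ^ e ≤
      2 ^ ((20 * c + 20 * c') * (chunkCount φ.numVars + 1)) := by
    intro e he
    refine (Nat.pow_le_pow_left (reductionWeight_le h3 ho) e).trans ?_
    rw [← pow_mul]
    refine Nat.pow_le_pow_right (by norm_num) ?_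
    nlinarith
  refine ⟨instanceOf _ _ hspec, t, ?_, (ht.trans (hT _)).trans (hW c (by omega)), ?_, ?_,
    by omega, ?_, by omega, by omega, ?_⟩
  · rw [henc, ← stackStore_nil, ← stackStore_nil, ← toVal_formulaData]
    exact hexec
  · unfold VectorSumInstance.size
    rw [henc]
    exact (hs _).trans (hW c' (by omega))
  -- Without variables there is no chunk to supply a large group, but then the claim is `1 ≤ I.size
  -- ^ 2`.
  · rcases Nat.eq_zero_or_pos φ.numVars with h0 | h0
    · have h1 := sq_chunkCount_le φ.numVars
      have h2 : chunkCount φ.numVars = 0 := by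
        rw [h0] at h1 ⊢
        simpa using h1
      rw [h2, pow_zero]
      exact Nat.one_le_pow _ _ (Val.one_le_size _)
    · obtain ⟨ch, hch, hle⟩ := exists_mem_chunks (l := List.range φ.numVars) (by simp; omega)
      have h1 : 2 ^ ch.length ≤ (instanceOf _ _ hspec).size := by
        have hg : groupOf varKey varTest [true, false]
            (slotsOf (paddedClauses (formulaData φ))) ch ∈
            (reduction (formulaData φ)).1 :=
          List.mem_append_left _ (List.mem_map_of_mem hch)
        have h2 := vsize_lt_of_mem hg
        have h3 := length_lt_vsize (groupOf varKey varTest [true, false]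
            (slotsOf (paddedClauses (formulaData φ))) ch)
        rw [groupOf, List.length_map, length_choices] at h3
        have h4 : vsize (reduction (formulaData φ)).1 ≤ vsize (reduction (formulaData φ)) := by
          rw [show vsize (reduction (formulaData φ)) = vsize (reduction (formulaData φ)).1 +
            vsize (reduction (formulaData φ)).2 + 1 from rfl]
          omega
        unfold VectorSumInstance.size
        rw [henc]
        exact ((h3.trans h2).le.trans h4)
      calc 2 ^ chunkCount φ.numVars ≤ 2 ^ (2 * ch.length) :=
            Nat.pow_le_pow_right (by norm_num) hle
        _ = (2 ^ ch.length) ^ 2 := by rw [← pow_mul, mul_comm]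
        _ ≤ _ := Nat.pow_le_pow_left h1 2
  · rw [hk]
    have := chunkCount_le_mul (m := (paddedClauses (formulaData φ)).length) (n := φ.numVars)
      (by omega)
    omega
  · rw [hasSolution_instanceOf, satisfiable_iff h3,
      zero_mem_sum_vectorGroups (varsExactly_paddedClauses h3)]

end WhileLang

namespace WhileLang

open Filter Asymptotics

/-! ### Growth rates -/

/-- The running maximum makes `g` monotone and nonnegative, so that an upper bound on `k` suffices
later. Indices up to `K` contribute only a constant, which is at most `ε * m` for large `m`. -/
theorem isLittleO_partialSups {g : ℕ → ℝ} (hg : g =o[atTop] fun k : ℕ => (k : ℝ)) :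
    (fun m => partialSups (fun k => |g k|) m) =o[atTop] fun m : ℕ => (m : ℝ) := by
  rw [isLittleO_iff] at hg ⊢
  intro ε hε
  obtain ⟨K, hK⟩ := eventually_atTop.1 (hg hε)
  filter_upwards [tendsto_natCast_atTop_atTop.eventually_ge_atTop
    (partialSups (fun k => |g k|) K / ε)] with m hm
  rw [div_le_iff₀ hε, mul_comm] at hm
  have h0 : 0 ≤ partialSups (fun k => |g k|) m :=
    (abs_nonneg (g 0)).trans (le_partialSups_of_le (fun k => |g k|) (Nat.zero_le m))
  rw [Real.norm_of_nonneg h0, Real.norm_of_nonneg m.cast_nonneg]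
  refine partialSups_le _ _ _ fun i hi => ?_
  rcases le_total i K with h | h
  · exact (le_partialSups_of_le (fun k => |g k|) h).trans hm
  · have := hK i h
    rw [Real.norm_eq_abs, Real.norm_of_nonneg i.cast_nonneg] at this
    have hi' : (i : ℝ) ≤ m := Nat.cast_le.2 hi
    nlinarith

theorem tendsto_chunkCount : Tendsto chunkCount atTop atTop := by
  refine tendsto_atTop.2 fun b => ?_
  filter_upwards [eventually_ge_atTop (b ^ 2)] with n hn
  exact (Nat.pow_le_pow_iff_left two_ne_zero).1 (hn.trans (le_sq_chunkCount n))

/-- With `r = chunkCount n`, the exponent is `O(r) * o(r) = o(r ^ 2)`, and `r ^ 2 ≤ 4 * n`. The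
summand `1` pays for the reduction itself. -/
theorem isLittleO_exponent {g : ℕ → ℝ} (hg : g =o[atTop] fun k : ℕ => (k : ℝ)) (A : ℝ) :
    (fun n => A * ((chunkCount n : ℝ) + 1) *
      (1 + partialSups (fun k => |g k|) (5 * chunkCount n))) =o[atTop] fun n : ℕ => (n : ℝ) := by
  have hone : (fun _ : ℕ => (1 : ℝ)) =o[atTop] fun m : ℕ => (m : ℝ) :=
    isLittleO_const_left.2 (.inr (tendsto_norm_atTop_atTop.comp tendsto_natCast_atTop_atTop))
  have h5 : Tendsto (fun m : ℕ => 5 * m) atTop atTop :=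
    tendsto_id.const_mul_atTop' (by norm_num)
  have h1 : (fun m : ℕ => 1 + partialSups (fun k => |g k|) (5 * m)) =o[atTop]
      fun m : ℕ => (m : ℝ) := by
    refine hone.add (((isLittleO_partialSups hg).comp_tendsto h5).trans_isBigO ?_)
    refine IsBigO.of_bound 5 (Eventually.of_forall fun m => ?_)
    simp
  have h2 : (fun m : ℕ => A * ((m : ℝ) + 1)) =O[atTop] fun m : ℕ => (m : ℝ) :=
    ((isBigO_refl _ _).add hone.isBigO).const_mul_left A
  refine ((h2.mul_isLittleO h1).comp_tendsto tendsto_chunkCount).trans_isBigO ?_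
  refine IsBigO.of_bound 4 (Eventually.of_forall fun n => ?_)
  have := sq_chunkCount_le n
  rw [Function.comp, Real.norm_of_nonneg (by positivity), Real.norm_of_nonneg n.cast_nonneg]
  rw [← sq]
  exact_mod_cast this

end WhileLang

/-! ### Conclusion: constants and running time -/

open WhileLang

theorem mainTheorem3 (hETH : ExponentialTimeHypothesis) :
    ∃ c₁ c₂ : ℝ, 0 < c₁ ∧ c₁ ≤ c₂ ∧
      ¬ ∃ (p : WhileLang.Prog) (g : ℕ → ℝ) (C : ℝ),
          g =o[Filter.atTop] (fun k : ℕ => (k : ℝ)) ∧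
          ∀ I : VectorSumInstance,
            c₁ * (I.k * Real.log I.size) ≤ I.d → (I.d : ℝ) ≤ c₂ * (I.k * Real.log I.size) →
            p.AnswersWithin I.encode I.HasSolution (C * (I.size : ℝ) ^ g I.k) := by
  obtain ⟨q, A, hq⟩ := exists_reduction
  have hc : (3 : ℝ) / (40 * (A + 1)) ≤ 3 :=
    div_le_self (by norm_num) (by have : (0 : ℝ) ≤ A := A.cast_nonneg; linarith)
  -- Lower bound: `d ≥ 3 * N` and `k * log n ≤ 5 * r * A * (r + 1) ≤ 40 * A * N`, with `A + 1`
  -- keeping the denominator positive. Upper bound: `d ≤ 12 * N` and `k * log n ≥ r * (r / 4) ≥ N /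
  -- 4`.
  refine ⟨3 / (40 * (A + 1)), 48, by positivity, by linarith, ?_⟩
  rintro ⟨p, g, C, hg, hp⟩
  -- The term `|C|` covers the run of `p`, where `C` might be negative, and `1` covers the
  -- reduction.
  refine hETH ⟨.seq q p, _, |C| + 1, isLittleO_exponent hg A, fun φ h3 ho => ?_⟩
  obtain ⟨I, t, hexec, ht, hsize, hsize', hk, hk', hd, hd', hsol⟩ := hq φ h3 ho
  have hr := le_sq_chunkCount φ.numVars
  have hr' := sq_chunkCount_le φ.numVars
  generalize chunkCount φ.numVars = r at *
  have hlog2 : (1 : ℝ) / 2 < Real.log 2 := by have := Real.log_two_gt_d9; linarith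
  have hlog2' : Real.log 2 < 1 := by have := Real.log_two_lt_d9; linarith
  have hsz : (1 : ℝ) ≤ I.size := Nat.one_le_cast.2 (Val.one_le_size _)
  have hlog_le : Real.log I.size ≤ A * (r + 1) := by
    have h1 : (I.size : ℝ) ≤ 2 ^ (A * (r + 1)) := by exact_mod_cast hsize
    have h2 := Real.log_le_log (by linarith) h1
    rw [Real.log_pow] at h2
    push_cast at h2
    have h3 : (0 : ℝ) ≤ A * (r + 1) := by positivity
    nlinarith
  have hlog_ge : (r : ℝ) / 4 ≤ Real.log I.size := by
    have h1 : (2 : ℝ) ^ r ≤ (I.size : ℝ) ^ 2 := by exact_mod_cast hsize'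
    have h2 := Real.log_le_log (by positivity) h1
    rw [Real.log_pow, Real.log_pow] at h2
    push_cast at h2
    have h3 : (0 : ℝ) ≤ r := r.cast_nonneg
    nlinarith
  have hk1 : (r : ℝ) ≤ I.k := by exact_mod_cast hk
  have hk2 : (I.k : ℝ) ≤ 5 * r := by exact_mod_cast hk'
  have hd1 : 3 * (φ.numVars : ℝ) ≤ I.d := by exact_mod_cast hd
  have hd2 : (I.d : ℝ) ≤ 12 * φ.numVars := by exact_mod_cast hd'
  have hr1 : (φ.numVars : ℝ) ≤ (r : ℝ) ^ 2 := by exact_mod_cast hr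
  have hr2 : (r : ℝ) ^ 2 ≤ 4 * φ.numVars := by exact_mod_cast hr'
  have hr0 : (0 : ℝ) ≤ r := r.cast_nonneg
  have hA0 : (0 : ℝ) ≤ A := A.cast_nonneg
  have hrr : (r : ℝ) ≤ (r : ℝ) ^ 2 := by exact_mod_cast Nat.le_self_pow two_ne_zero r
  obtain ⟨u, s, hexec', hu, hs⟩ := hp I (by
    have h1 : (I.k : ℝ) * Real.log I.size ≤ 5 * r * (A * (r + 1)) :=
      mul_le_mul hk2 hlog_le (Real.log_nonneg hsz) (by positivity)
    have h2 : 5 * r * (A * (r + 1)) ≤ (A + 1 : ℝ) * (40 * φ.numVars) := by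
      have h3 : 5 * ((r : ℝ) ^ 2 + r) ≤ 40 * φ.numVars := by linarith
      have h4 : (A : ℝ) * (5 * ((r : ℝ) ^ 2 + r)) ≤ A * (40 * φ.numVars) :=
        mul_le_mul_of_nonneg_left h3 hA0
      have h5 : (0 : ℝ) ≤ φ.numVars := φ.numVars.cast_nonneg
      nlinarith
    rw [div_mul_eq_mul_div, div_le_iff₀ (by positivity)]
    nlinarith) (by
    have h1 : (r : ℝ) * (r / 4) ≤ I.k * Real.log I.size :=
      mul_le_mul hk1 hlog_ge (by positivity) (by positivity)
    nlinarith)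
  refine ⟨t + u, s, .seq hexec hexec', ?_, hs.trans hsol⟩
  -- The number of groups varies with the formula for a given `r`; `G` bounds `g` at all values up
  -- to `5 * r` and depends on `N` alone.
  set G : ℝ := partialSups (fun k => |g k|) (5 * r)
  have hgG : g I.k ≤ G := (le_abs_self _).trans (le_partialSups_of_le (fun k => |g k|) hk')
  have hG0 : 0 ≤ G := (abs_nonneg (g 0)).trans
    (le_partialSups_of_le (fun k => |g k|) (Nat.zero_le _))
  have hAr : (0 : ℝ) ≤ A * (r + 1) := by positivity
  have h1 : (t : ℝ) ≤ (2 : ℝ) ^ (A * ((r : ℝ) + 1) * (1 + G)) := by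
    calc (t : ℝ) ≤ (2 : ℝ) ^ (A * (r + 1)) := by exact_mod_cast ht
      _ = (2 : ℝ) ^ ((A : ℝ) * (r + 1)) := by rw [← Real.rpow_natCast]; push_cast; rfl
      _ ≤ _ := Real.rpow_le_rpow_of_exponent_le (by norm_num) (by nlinarith)
  have h2 : (I.size : ℝ) ^ g I.k ≤ (2 : ℝ) ^ (A * ((r : ℝ) + 1) * (1 + G)) := by
    calc (I.size : ℝ) ^ g I.k ≤ (I.size : ℝ) ^ G := Real.rpow_le_rpow_of_exponent_le hsz hgG
      _ ≤ ((2 : ℝ) ^ (A * (r + 1))) ^ G :=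
        Real.rpow_le_rpow (by linarith) (by exact_mod_cast hsize) hG0
      _ = (2 : ℝ) ^ ((A : ℝ) * (r + 1) * G) := by
        rw [← Real.rpow_natCast, ← Real.rpow_mul (by norm_num)]; push_cast; rfl
      _ ≤ _ := Real.rpow_le_rpow_of_exponent_le (by norm_num) (by nlinarith)
  have h3 : C * (I.size : ℝ) ^ g I.k ≤ |C| * (2 : ℝ) ^ (A * ((r : ℝ) + 1) * (1 + G)) :=
    mul_le_mul (le_abs_self C) h2 (by positivity) (abs_nonneg C)
  push_cast
  rw [add_mul, one_mul]
  linarith
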